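/- **Setting.** Fix integers $K,d\ge 1$ and $T\ge 0$, a measurable space $\mathcal X$ of contexts (not assumed finite) with a probability distribution $\mathcal G$, sets $\mathcal Z,\Theta\subset\mathbb R^d$, and a known feature map $\phi:[K]\times\mathcal X\to\mathcal Z$, measurable in the context, with $|\langle z,\theta\rangle|\le 1$ for all $z\in\mathcal Z$, $\theta\in\Theta$. Let $\mathcal P_K$ be the probability simplex in $\mathbb R^K$. For a family $p=(p_x)_{x\in\mathcal X}$ in $\mathcal P_K$ let $\Sigma(p)=\mathbb E_{X\sim\mathcal G,\,a\sim p_X}[\phi(a,X)\phi(a,X)^\top]$. Let $\lambda>0$ and let $e^*=(e^*_x)_{x\in\mathcal X}$ be a measurable family in $\mathcal P_K$ such that $\Sigma(e^*)$ is well defined and invertible and $z^\top\Sigma(e^*)^{-1}z\le 1/\lambda$ for all $z\in\mathcal Z$. In each round $t=1,\dots,T$: nature chooses $\theta_t\in\Theta$ in an arbitrary way from the history $\mathcal F_{t-1}=((X_s,A_s,\ell_s(A_s,X_s)))_{s<t}$ (possibly with randomization); a context $X_t\sim\mathcal G$ is drawn independently of $(\mathcal F_{t-1},\theta_t)$; the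 learner observes $X_t$, draws an arm $A_t\in[K]$ from a distribution $\pi_t(X_t)$ and observes the loss $\ell_t(A_t,X_t)$. Here $\ell_t(a,x)=\langle\phi(a,x),\theta_t\rangle+\varepsilon_t(a)$ with $\mathbb E[\varepsilon_t(a)\mid X_t,\mathcal F_{t-1},\theta_t]=0$, almost surely $|\ell_t(a,x)|\le 1$ for all $a,x$, and $A_t$ has conditional distribution $\pi_t(X_t)$ given $(\mathcal F_{t-1},\theta_t,X_t,\varepsilon_t)$. The regret is $$R_T=\sup_{\rho:\mathcal X\to[K]\text{ measurable}}\ \mathbb E\Big[\sum_{t=1}^T\big(\ell_t(A_t,X_t)-\ell_t(\rho(X_t),X_t)\big)\Big].$$ **Algorithm ($1/2$-LC-Tsallis-INF, parameters not relying on a finite context support).** Put $\eta_0=\lambda/16$ and, for $t\ge1$, $$\eta_t=\min\Big\{\frac{K^{1/4}}{\sqrt{dt}},\ \frac{\lambda}{16}\Big\},\qquad \gamma_t=\frac{8\eta_t}{\lambda}\ \Big(\le\frac12\Big),\qquad \pi_t(x)=(1-\gamma_t)\,q_t(x)+\gamma_t\,e^*_x,$$ $$q_t(x)=\operatorname*{arg\,min}_{q\in\mathcal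 P_K}\Big\{\sum_{s=1}^{t-1}\sum_{a=1}^K q_a\langle\widehat\theta_s,\phi(a,x)\rangle+\frac1{\eta_{t-1}}\psi(q)\Big\},\qquad \psi(q)=2\Big(1-\sum_{a=1}^K\sqrt{q_a}\Big),$$ $$\widehat\theta_t=\Sigma_t^{-1}\phi(A_t,X_t)\,\ell_t(A_t,X_t),\qquad \Sigma_t=\Sigma(\pi_t).$$ **Theorem.** There is an absolute constant $C>0$ such that in every such setting the supremum that defines $R_T$ is finite and $$R_T\le C\left(\sqrt{d\sqrt K\,T}+\frac1\lambda\left(\sqrt K+\frac{\sqrt{\sqrt K\,T}}{\sqrt d}\right)\right).$$ -/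

import Mathlib

open MeasureTheory

noncomputable section

namespace LCTsallisINF

/-- The matrix `Σ(p) = E_{X ∼ G, a ∼ p_X} [φ(a, X) φ(a, X)ᵀ]` of a family `p` of conditional
distributions over the `K` arms. -/
def cov {𝒳 : Type*} [MeasurableSpace 𝒳] {K d : ℕ} (G : Measure 𝒳)
    (φ : Fin K → 𝒳 → Fin d → ℝ) (p : 𝒳 → Fin K → ℝ) : Matrix (Fin d) (Fin d) ℝ :=
  Matrix.of fun i j => ∫ x, ∑ a, p x a * (φ a x i * φ a x j) ∂G

/-- `e` is an exploration policy with parameter `lam > 0`: a measurable family of distributions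
over the arms whose matrix `Σ(e)` is invertible with `zᵀ Σ(e)⁻¹ z ≤ 1 / lam` on the feature
space `𝒵`. Since `Σ(e)` is an average of the matrices `φ φᵀ`, it is invertible iff it is positive
definite; asking for positive definiteness also says that the integrals which define it converge
(a divergent diagonal entry would be the default value `0`). -/
structure IsExploration {𝒳 : Type*} [MeasurableSpace 𝒳] {K d : ℕ} (G : Measure 𝒳)
    (φ : Fin K → 𝒳 → Fin d → ℝ) (𝒵 : Set (Fin d → ℝ)) (lam : ℝ) (e : 𝒳 → Fin K → ℝ) :
    Prop where
  lam_pos : 0 < lam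
  measurable : Measurable e
  mem_simplex : ∀ x, e x ∈ stdSimplex ℝ (Fin K)
  posDef : (cov G φ e).PosDef
  quad_le : ∀ z ∈ 𝒵, z ⬝ᵥ ((cov G φ e)⁻¹).mulVec z ≤ 1 / lam

/-- The `α`-Tsallis entropy regularizer `ψ(q) = (1 - ∑ a, q(a) ^ α) / α`. -/
def tsallis (α : ℝ) {K : ℕ} (q : Fin K → ℝ) : ℝ :=
  1 / α * (1 - ∑ a, q a ^ α)

/-- The minimizer over the probability simplex of `q ↦ ⟨c, q⟩ + ψ(q) / η`
(for `0 < α < 1`, `η > 0` and `K ≥ 1` it exists and is unique). -/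
def ftrl (α η : ℝ) {K : ℕ} (c : Fin K → ℝ) : Fin K → ℝ :=
  Classical.epsilon fun q => q ∈ stdSimplex ℝ (Fin K) ∧
    IsMinOn (fun q' : Fin K → ℝ => c ⬝ᵥ q' + 1 / η * tsallis α q') (stdSimplex ℝ (Fin K)) q

/-- The learning rate `η_t = min {K^(1/4) / √(d t), lam / 16}`, which is `lam / 16` at `t = 0`,
where the first term is infinite. -/
def learningRate (K d : ℕ) (lam : ℝ) (t : ℕ) : ℝ :=
  if t = 0 then lam / 16
  else min ((K : ℝ) ^ (1 / 4 : ℝ) / √((d : ℝ) * t)) (lam / 16)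

/-- The exploration rate `γ_t = 8 η_t / lam ≤ 1 / 2`. -/
def explorationRate (K d : ℕ) (lam : ℝ) (t : ℕ) : ℝ :=
  8 * learningRate K d lam t / lam

/-- The FTRL weights `q_t(x)` of round `t ≥ 1`. Here `S` is the sum `∑ s < t, θ̂_s` of the
estimates of the earlier rounds, so the cumulative estimated loss of arm `a` at the context `x`
is `⟨S, φ(a, x)⟩`; the learning rate used is `η_{t-1}`. -/
def weights (α : ℝ) {𝒳 : Type*} {K d : ℕ} (φ : Fin K → 𝒳 → Fin d → ℝ) (lam : ℝ) (t : ℕ)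
    (S : Fin d → ℝ) (x : 𝒳) : Fin K → ℝ :=
  ftrl α (learningRate K d lam (t - 1)) fun a => S ⬝ᵥ φ a x

/-- The policy `π_t(x) = (1 - γ_t) q_t(x) + γ_t e(x)` of round `t ≥ 1`. -/
def policy (α : ℝ) {𝒳 : Type*} {K d : ℕ} (φ : Fin K → 𝒳 → Fin d → ℝ) (lam : ℝ)
    (e : 𝒳 → Fin K → ℝ) (t : ℕ) (S : Fin d → ℝ) (x : 𝒳) : Fin K → ℝ :=
  (1 - explorationRate K d lam t) • weights α φ lam t S x + explorationRate K d lam t • e x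

/-- The estimate `θ̂_t = Σ_t⁻¹ φ(a, x) y` of round `t ≥ 1`, when the context `x`, the arm `a` and
the loss `y` were observed; `Σ_t = Σ(π_t)`. -/
def thetaHat (α : ℝ) {𝒳 : Type*} [MeasurableSpace 𝒳] {K d : ℕ} (G : Measure 𝒳)
    (φ : Fin K → 𝒳 → Fin d → ℝ) (lam : ℝ) (e : 𝒳 → Fin K → ℝ) (t : ℕ) (S : Fin d → ℝ)
    (x : 𝒳) (a : Fin K) (y : ℝ) : Fin d → ℝ :=
  y • ((cov G φ (policy α φ lam e t S))⁻¹).mulVec (φ a x)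

/-- `cumEstimate … t = ∑ s ∈ {1, …, t}, θ̂_s` along the observed contexts `X 1, X 2, …`,
arms `A 1, A 2, …` and losses `Y 1, Y 2, …`. -/
def cumEstimate (α : ℝ) {𝒳 : Type*} [MeasurableSpace 𝒳] {K d : ℕ} (G : Measure 𝒳)
    (φ : Fin K → 𝒳 → Fin d → ℝ) (lam : ℝ) (e : 𝒳 → Fin K → ℝ)
    (X : ℕ → 𝒳) (A : ℕ → Fin K) (Y : ℕ → ℝ) : ℕ → Fin d → ℝ
  | 0 => 0
  | t + 1 => cumEstimate α G φ lam e X A Y t +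
      thetaHat α G φ lam e (t + 1) (cumEstimate α G φ lam e X A Y t)
        (X (t + 1)) (A (t + 1)) (Y (t + 1))

/-- The loss `ℓ_t(a, x) = ⟨φ(a, x), θ_t⟩ + ε_t(a)`. -/
def loss {Ω 𝒳 : Type*} {K d : ℕ} (φ : Fin K → 𝒳 → Fin d → ℝ) (θ : ℕ → Ω → Fin d → ℝ)
    (ε : ℕ → Ω → Fin K → ℝ) (t : ℕ) (a : Fin K) (x : 𝒳) (ω : Ω) : ℝ :=
  φ a x ⬝ᵥ θ t ω + ε t ω a

/-- The policy value `π_t(a ∣ X_t)` which the algorithm computes in round `t ≥ 1` from what it has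
observed. -/
def playedProb (α : ℝ) {Ω 𝒳 : Type*} [MeasurableSpace 𝒳] {K d : ℕ} (G : Measure 𝒳)
    (φ : Fin K → 𝒳 → Fin d → ℝ) (lam : ℝ) (e : 𝒳 → Fin K → ℝ) (X : ℕ → Ω → 𝒳)
    (A : ℕ → Ω → Fin K) (θ : ℕ → Ω → Fin d → ℝ) (ε : ℕ → Ω → Fin K → ℝ) (t : ℕ) (a : Fin K)
    (ω : Ω) : ℝ :=
  policy α φ lam e t
    (cumEstimate α G φ lam e (fun s => X s ω) (fun s => A s ω)
      (fun s => loss φ θ ε s (A s ω) (X s ω) ω) (t - 1)) (X t ω) a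

/-- The `σ`-algebra generated by the observed history `F_{t-1}`, that is, by the triples
`(X_s, A_s, ℓ_s(A_s, X_s))` with `1 ≤ s < t`. -/
@[reducible] def history {Ω 𝒳 : Type*} [MeasurableSpace 𝒳] {K d : ℕ} (φ : Fin K → 𝒳 → Fin d → ℝ)
    (X : ℕ → Ω → 𝒳) (A : ℕ → Ω → Fin K) (θ : ℕ → Ω → Fin d → ℝ) (ε : ℕ → Ω → Fin K → ℝ)
    (t : ℕ) : MeasurableSpace Ω :=
  ⨆ s ∈ Finset.Ico 1 t, MeasurableSpace.comap
    (fun ω => (X s ω, A s ω, loss φ θ ε s (A s ω) (X s ω) ω)) inferInstance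

/-- The `σ`-algebra generated by `F_{t-1}` and by nature's choice `θ_t`. It is that of `F_{t-1}`
when nature chooses `θ_t` as a function of the history; a nature that randomizes is covered too. -/
@[reducible] def natureInfo {Ω 𝒳 : Type*} [MeasurableSpace 𝒳] {K d : ℕ} (φ : Fin K → 𝒳 → Fin d → ℝ)
    (X : ℕ → Ω → 𝒳) (A : ℕ → Ω → Fin K) (θ : ℕ → Ω → Fin d → ℝ) (ε : ℕ → Ω → Fin K → ℝ)
    (t : ℕ) : MeasurableSpace Ω :=
  history φ X A θ ε t ⊔ MeasurableSpace.comap (θ t) inferInstance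

/-- The random variables of rounds `1, …, T` when the `α`-LC-Tsallis-INF plays against an
arbitrary (adaptive) choice of the parameters `θ_t`. -/
structure IsRun (α : ℝ) {Ω 𝒳 : Type*} [MeasurableSpace Ω] [MeasurableSpace 𝒳] {K d : ℕ}
    (P : Measure Ω) (G : Measure 𝒳) (φ : Fin K → 𝒳 → Fin d → ℝ) (Θ : Set (Fin d → ℝ))
    (lam : ℝ) (e : 𝒳 → Fin K → ℝ) (T : ℕ) (X : ℕ → Ω → 𝒳) (A : ℕ → Ω → Fin K)
    (θ : ℕ → Ω → Fin d → ℝ) (ε : ℕ → Ω → Fin K → ℝ) : Prop where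
  measurable_X : ∀ t ∈ Finset.Icc 1 T, Measurable (X t)
  measurable_A : ∀ t ∈ Finset.Icc 1 T, Measurable (A t)
  measurable_θ : ∀ t ∈ Finset.Icc 1 T, Measurable (θ t)
  measurable_ε : ∀ t ∈ Finset.Icc 1 T, Measurable (ε t)
  /-- Nature's parameters lie in the parameter space. -/
  θ_mem : ∀ t ∈ Finset.Icc 1 T, ∀ᵐ ω ∂P, θ t ω ∈ Θ
  /-- The losses are bounded by one. -/
  loss_le : ∀ t ∈ Finset.Icc 1 T, ∀ᵐ ω ∂P, ∀ a x, |loss φ θ ε t a x ω| ≤ 1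
  /-- Every context has law `G` … -/
  law_X : ∀ t ∈ Finset.Icc 1 T, P.map (X t) = G
  /-- … and is drawn independently of the past and of nature's choice; in particular the contexts
  are i.i.d. -/
  indep_X : ∀ t ∈ Finset.Icc 1 T, ProbabilityTheory.Indep
    (MeasurableSpace.comap (X t) inferInstance) (natureInfo φ X A θ ε t) P
  /-- The noise has conditional mean zero. -/
  noise : ∀ t ∈ Finset.Icc 1 T, ∀ a,
    P[fun ω => ε t ω a | natureInfo φ X A θ ε t ⊔ MeasurableSpace.comap (X t) inferInstance]
      =ᵐ[P] 0
  /-- The arm is drawn from `π_t(X_t)`, with randomness of its own: given the past, the parameter,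
  the context and the noise, arm `a` has conditional probability `π_t(a ∣ X_t)`. -/
  action : ∀ t ∈ Finset.Icc 1 T, ∀ a,
    P[(A t ⁻¹' {a}).indicator (fun _ => (1 : ℝ)) | natureInfo φ X A θ ε t ⊔
        MeasurableSpace.comap (X t) inferInstance ⊔ MeasurableSpace.comap (ε t) inferInstance]
      =ᵐ[P] playedProb α G φ lam e X A θ ε t a

/-- The expected excess loss `E[∑_{t ≤ T} (ℓ_t(A_t, X_t) - ℓ_t(ρ(X_t), X_t))]` over the comparator
policy `ρ`. -/
def regretAgainst {Ω 𝒳 : Type*} [MeasurableSpace Ω] {K d : ℕ} (P : Measure Ω)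
    (φ : Fin K → 𝒳 → Fin d → ℝ) (T : ℕ) (X : ℕ → Ω → 𝒳) (A : ℕ → Ω → Fin K)
    (θ : ℕ → Ω → Fin d → ℝ) (ε : ℕ → Ω → Fin K → ℝ) (ρ : 𝒳 → Fin K) : ℝ :=
  ∫ ω, ∑ t ∈ Finset.Icc 1 T,
    (loss φ θ ε t (A t ω) (X t ω) ω - loss φ θ ε t (ρ (X t ω)) (X t ω) ω) ∂P

/-- The regret `R_T`: the supremum of `regretAgainst` over all measurable `ρ : 𝒳 → [K]`. -/
def regret {Ω 𝒳 : Type*} [MeasurableSpace Ω] [MeasurableSpace 𝒳] {K d : ℕ} (P : Measure Ω)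
    (φ : Fin K → 𝒳 → Fin d → ℝ) (T : ℕ) (X : ℕ → Ω → 𝒳) (A : ℕ → Ω → Fin K)
    (θ : ℕ → Ω → Fin d → ℝ) (ε : ℕ → Ω → Fin K → ℝ) : ℝ :=
  ⨆ ρ : {ρ : 𝒳 → Fin K // Measurable ρ}, regretAgainst P φ T X A θ ε ρ.1

end LCTsallisINF

end

noncomputable section

namespace LCTsallisINF

/-! ### Follow the regularized leader with the 1/2-Tsallis entropy on the simplex. -/

section FTRL

/-! Fix one trajectory and one context `x`. The weights at `x` are those of follow the regularized
leader (FTRL) with losses `⟨θ̂_t, φ(a, x)⟩`, so a deterministic regret bound (`sum_ftrl_le`) holds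
for every `x`, observed or not. It consists of a penalty `2√K / η_T` and second-order terms `2
η_{t-1} ∑ q(a) ⟨θ̂_t, φ(a, x)⟩²`. Integrating it over `x ∼ G` is what removes the finite context
support: the integrated regret is `∑ gap_t ⬝ᵥ θ̂_t`, where the vector `gap_t` depends only on the
past (`IsExploration.sum_gap_dotProduct_le`).

Three facts about `Σ_t` turn this into a regret bound. Since `gap_t` is determined by the history
and `Σ_t⁻¹` undoes the averaging of `φ φᵀ`, the estimate may be replaced in expectation by `θ_t`
(`IsRun.integral_gap_dotProduct`). The mixture keeps at least half of the FTRL weights, so the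
second moment of the estimated losses is at most twice the leverage `φᵀ Σ_t⁻¹ φ` of the played arm,
whose mean is `tr (Σ_t⁻¹ Σ_t) = d`, independently of `K`
(`IsExploration.integral_weights_mul_sq_le`, `IsRun.integral_leverage`). Finally `Σ_t` dominates
`γ_t Σ(e)`, so the estimated losses are at most `1 / (8 η_t)`, and the stability analysis applies
(`IsExploration.abs_feature_inv_feature_le`).

Playing the mixture instead of the weights costs at most `2 γ_t` per round
(`IsRun.integral_loss_sub_le`). Altogether the regret is at most `2√K / η_T + ∑ (4 d η_{t-1} + 2
γ_t)`. The rate `K^(1/4) / √(d t)` balances the penalty against the variance, while the cap `lam /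
16` and the exploration account for the `1 / lam` terms. -/

lemma tsallis_half {K : ℕ} (q : Fin K → ℝ) : tsallis (1 / 2) q = 2 * (1 - ∑ a, √(q a)) := by
  simp only [tsallis, Real.sqrt_eq_rpow]
  norm_num

/-- The stationarity condition for the `1/2`-Tsallis regularized problem on the simplex. -/
structure IsStationary (η : ℝ) {K : ℕ} (c q : Fin K → ℝ) : Prop where
  pos : ∀ a, 0 < q a
  sum_eq : ∑ a, q a = 1
  multiplier : ∃ ν, ∀ a, c a = ν + 1 / (η * √(q a))

/-- The stationarity equations give every weight as a function of the multiplier alone, so only a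
scalar normalization has to be solved, by the intermediate value theorem. This also makes all
weights strictly positive without a separate boundary argument. -/
lemma exists_isStationary {η : ℝ} (hη : 0 < η) {K : ℕ} (hK : 0 < K) (c : Fin K → ℝ) :
    ∃ q, IsStationary η c q := by
  have : Nonempty (Fin K) := ⟨⟨0, hK⟩⟩
  obtain ⟨b, hb⟩ := Finite.exists_min c
  have hK1 : (1 : ℝ) ≤ √(K : ℝ) := Real.one_le_sqrt.mpr (by exact_mod_cast hK)
  -- The total mass for the multiplier `c b - s`. At `s = 1 / η` the cheapest arm `b` alone has mass
  -- 1; at `s = √K / η` every arm has mass at most `1 / K`.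
  let f : ℝ → ℝ := fun s => ∑ a, 1 / (η * (c a - c b + s)) ^ 2
  have hden : ∀ s, 1 / η ≤ s → ∀ a, 1 / η ≤ c a - c b + s := fun s hs a => by
    linarith [hb a]
  have hηpos : 0 < 1 / η := by positivity
  have hle : 1 / η ≤ √(K : ℝ) / η := by gcongr
  have hcont : ContinuousOn f (Set.Icc (1 / η) (√(K : ℝ) / η)) := by
    refine continuousOn_finsetSum _ fun a _ => ContinuousOn.div (by fun_prop) (by fun_prop) ?_
    intro s hs
    have := hden s hs.1 a
    have : 0 < c a - c b + s := by linarith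
    positivity
  have h1 : 1 ≤ f (1 / η) := by
    have : 1 / (η * (c b - c b + 1 / η)) ^ 2 ≤ f (1 / η) :=
      Finset.single_le_sum (f := fun a => 1 / (η * (c a - c b + 1 / η)) ^ 2)
        (fun a _ => by positivity) (Finset.mem_univ b)
    rw [sub_self, zero_add, mul_one_div_cancel hη.ne'] at this
    simpa using this
  have h2 : f (√(K : ℝ) / η) ≤ 1 := by
    have : ∀ a ∈ (Finset.univ : Finset (Fin K)),
        1 / (η * (c a - c b + √(K : ℝ) / η)) ^ 2 ≤ 1 / (K : ℝ) := fun a _ => by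
      have h3 : √(K : ℝ) ≤ η * (c a - c b + √(K : ℝ) / η) := by
        have : η * (c a - c b + √(K : ℝ) / η) = η * (c a - c b) + √(K : ℝ) := by field_simp
        rw [this]
        nlinarith [hb a]
      have h4 : (K : ℝ) ≤ (η * (c a - c b + √(K : ℝ) / η)) ^ 2 := by
        calc (K : ℝ) = √(K : ℝ) ^ 2 := (Real.sq_sqrt (by positivity)).symm
          _ ≤ _ := by gcongr
      have : (0 : ℝ) < K := by exact_mod_cast hK
      gcongr
    refine (Finset.sum_le_card_nsmul _ _ _ this).trans ?_
    have : (K : ℝ) ≠ 0 := by exact_mod_cast hK.ne'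
    simp [this]
  obtain ⟨s, hs, hfs⟩ := intermediate_value_Icc' hle hcont ⟨h2, h1⟩
  have hpos : ∀ a, 0 < c a - c b + s := fun a => by linarith [hden s hs.1 a]
  refine ⟨fun a => 1 / (η * (c a - c b + s)) ^ 2, fun a => ?_, hfs, c b - s, fun a => ?_⟩
  · have := hpos a
    positivity
  · have := hpos a
    rw [Real.sqrt_div zero_le_one, Real.sqrt_sq (by positivity), Real.sqrt_one]
    field_simp
    ring

variable {η : ℝ} {K : ℕ} {c q : Fin K → ℝ}

lemma IsStationary.mem_simplex (h : IsStationary η c q) : q ∈ stdSimplex ℝ (Fin K) :=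
  ⟨fun a => (h.pos a).le, h.sum_eq⟩

lemma IsStationary.le_one (h : IsStationary η c q) (a : Fin K) : q a ≤ 1 :=
  h.sum_eq ▸ Finset.single_le_sum (f := q) (fun b _ => (h.pos b).le) (Finset.mem_univ a)

/-- The gap of the objective to a stationary point is exactly the Bregman divergence. -/
lemma IsStationary.objective_eq (hη : 0 < η) (h : IsStationary η c q) {p : Fin K → ℝ}
    (hp : p ∈ stdSimplex ℝ (Fin K)) :
    c ⬝ᵥ p + 1 / η * tsallis (1 / 2) p = c ⬝ᵥ q + 1 / η * tsallis (1 / 2) q +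
      ∑ a, (√(p a) - √(q a)) ^ 2 / (η * √(q a)) := by
  obtain ⟨ν, hν⟩ := h.multiplier
  -- The multiplier enters only through `ν * (p a - q a)`, which sums to zero because both points
  -- have mass 1.
  have key : ∀ a, (√(p a) - √(q a)) ^ 2 / (η * √(q a)) =
      c a * p a - c a * q a - ν * (p a - q a) - 2 / η * √(p a) + 2 / η * √(q a) := fun a => by
    have h1 : 0 < √(q a) := Real.sqrt_pos.mpr (h.pos a)
    have h2 := Real.sq_sqrt (h.pos a).le
    have h3 := Real.sq_sqrt (hp.1 a)
    rw [hν a]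
    generalize √(q a) = v at *
    generalize √(p a) = u at *
    rw [← h2, ← h3]
    field_simp
    ring
  simp only [key, tsallis_half, dotProduct, Finset.sum_add_distrib, Finset.sum_sub_distrib,
    ← Finset.mul_sum, hp.2, h.sum_eq]
  ring

/-- The minimizer chosen by `Classical.epsilon` has zero Bregman divergence from the stationary
point, and the divergence separates points of the simplex. -/
lemma IsStationary.ftrl_eq (hη : 0 < η) (h : IsStationary η c q) : ftrl (1 / 2) η c = q := by
  have hnn : ∀ p : Fin K → ℝ, ∀ a, 0 ≤ (√(p a) - √(q a)) ^ 2 / (η * √(q a)) := fun p a => by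
    positivity
  have hmin : q ∈ stdSimplex ℝ (Fin K) ∧ IsMinOn (fun q' : Fin K → ℝ =>
      c ⬝ᵥ q' + 1 / η * tsallis (1 / 2) q') (stdSimplex ℝ (Fin K)) q := by
    refine ⟨h.mem_simplex, fun p hp => ?_⟩
    have := h.objective_eq hη hp
    have h2 := Finset.sum_nonneg fun a (_ : a ∈ Finset.univ) => hnn p a
    simp only [Set.mem_ofPred_eq]
    linarith
  have hspec := Classical.epsilon_spec (p := fun q : Fin K → ℝ => q ∈ stdSimplex ℝ (Fin K) ∧
    IsMinOn (fun q' : Fin K → ℝ => c ⬝ᵥ q' + 1 / η * tsallis (1 / 2) q')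
      (stdSimplex ℝ (Fin K)) q) ⟨q, hmin⟩
  change ftrl (1 / 2) η c ∈ _ ∧ IsMinOn _ _ (ftrl (1 / 2) η c) at hspec
  set p := ftrl (1 / 2) η c
  have h1 := h.objective_eq hη hspec.1
  have h2 := hspec.2 h.mem_simplex
  simp only [Set.mem_ofPred_eq] at h2
  have h3 : ∑ a, (√(p a) - √(q a)) ^ 2 / (η * √(q a)) = 0 :=
    le_antisymm (by linarith) (Finset.sum_nonneg fun a _ => hnn p a)
  funext a
  have h4 := (Finset.sum_eq_zero_iff_of_nonneg fun a _ => hnn p a).mp h3 a (Finset.mem_univ a)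
  have h5 : 0 < √(q a) := Real.sqrt_pos.mpr (h.pos a)
  have h6 : √(p a) = √(q a) := by
    rcases div_eq_zero_iff.mp h4 with h | h
    · exact sub_eq_zero.mp (pow_eq_zero_iff (by norm_num) |>.mp h)
    · exact absurd h (by positivity)
  rwa [Real.sqrt_inj (hspec.1.1 a) (h.pos a).le] at h6

lemma isStationary_ftrl (hη : 0 < η) (hK : 0 < K) (c : Fin K → ℝ) :
    IsStationary η c (ftrl (1 / 2) η c) := by
  obtain ⟨q, hq⟩ := exists_isStationary hη hK c
  rwa [hq.ftrl_eq hη]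

/-- Adding the two divergence identities, each minimizer tested against the other, cancels the
entropies and leaves `⟨c - c', p - q⟩` as the sum of two divergences. The resulting Hölder estimate
serves to make the minimizer continuous, hence measurable, in the losses. -/
lemma ftrl_sub_sq_le (hη : 0 < η) (hK : 0 < K) (c c' : Fin K → ℝ) (a : Fin K) :
    (ftrl (1 / 2) η c' a - ftrl (1 / 2) η c a) ^ 2 ≤ 2 * η * ∑ b, |c' b - c b| := by
  have hq := isStationary_ftrl hη hK c
  have hp := isStationary_ftrl hη hK c'
  set q := ftrl (1 / 2) η c
  set p := ftrl (1 / 2) η c'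
  have h1 := hq.objective_eq hη hp.mem_simplex
  have h2 := hp.objective_eq hη hq.mem_simplex
  have key : ∀ b, (p b - q b) ^ 2 / (2 * η) ≤
      (√(p b) - √(q b)) ^ 2 / (η * √(q b)) + (√(q b) - √(p b)) ^ 2 / (η * √(p b)) := fun b => by
    have hu1 : √(p b) ≤ 1 := Real.sqrt_le_one.mpr (hp.le_one b)
    have hv1 : √(q b) ≤ 1 := Real.sqrt_le_one.mpr (hq.le_one b)
    have hu : 0 < √(p b) := Real.sqrt_pos.mpr (hp.pos b)
    have hv : 0 < √(q b) := Real.sqrt_pos.mpr (hq.pos b)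
    have e1 : (√(p b) - √(q b)) ^ 2 / η ≤ (√(p b) - √(q b)) ^ 2 / (η * √(q b)) := by
      gcongr
      nlinarith
    have e2 : (√(q b) - √(p b)) ^ 2 / η ≤ (√(q b) - √(p b)) ^ 2 / (η * √(p b)) := by
      gcongr
      nlinarith
    refine le_trans ?_ (add_le_add e1 e2)
    have e3 : (p b - q b) ^ 2 ≤ 4 * (√(p b) - √(q b)) ^ 2 := by
      have : p b - q b = (√(p b) - √(q b)) * (√(p b) + √(q b)) := by
        nlinarith [Real.sq_sqrt (hp.pos b).le, Real.sq_sqrt (hq.pos b).le]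
      rw [this, mul_pow]
      have : (√(p b) + √(q b)) ^ 2 ≤ 4 := by nlinarith
      nlinarith [sq_nonneg (√(p b) - √(q b))]
    rw [← add_div, div_le_div_iff₀ (by positivity) hη]
    nlinarith
  have h3 : ∑ b, (p b - q b) ^ 2 / (2 * η) ≤ ∑ b, |c' b - c b| := by
    refine (Finset.sum_le_sum fun b _ => key b).trans ?_
    rw [Finset.sum_add_distrib]
    have h4 : ∑ b, (c b - c' b) * (p b - q b) ≤ ∑ b, |c' b - c b| := by
      refine Finset.sum_le_sum fun b _ => (le_abs_self _).trans ?_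
      rw [abs_mul, abs_sub_comm (c b)]
      have : |p b - q b| ≤ 1 := abs_le.mpr
        ⟨by linarith [hp.pos b, hq.le_one b], by linarith [hq.pos b, hp.le_one b]⟩
      exact mul_le_of_le_one_right (abs_nonneg _) this
    have h5 : ∑ b, (c b - c' b) * (p b - q b) = c ⬝ᵥ p - c' ⬝ᵥ p - (c ⬝ᵥ q - c' ⬝ᵥ q) := by
      simp only [dotProduct, ← Finset.sum_sub_distrib]
      exact Finset.sum_congr rfl fun b _ => by ring
    linarith
  have h6 : (p a - q a) ^ 2 / (2 * η) ≤ ∑ b, |c' b - c b| :=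
    (Finset.single_le_sum (f := fun b => (p b - q b) ^ 2 / (2 * η))
      (fun b _ => by positivity) (Finset.mem_univ a)).trans h3
  rw [div_le_iff₀ (by positivity)] at h6
  linarith

lemma continuous_ftrl (hη : 0 < η) (hK : 0 < K) :
    Continuous (ftrl (1 / 2) η : (Fin K → ℝ) → Fin K → ℝ) := by
  refine continuous_pi fun a => continuous_iff_continuousAt.mpr fun c => ?_
  have h0 : Filter.Tendsto (fun c' : Fin K → ℝ => √(2 * η * ∑ b, |c' b - c b|)) (nhds c)
      (nhds 0) := by
    have : Continuous fun c' : Fin K → ℝ => √(2 * η * ∑ b, |c' b - c b|) := by fun_prop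
    simpa using this.tendsto c
  refine tendsto_iff_dist_tendsto_zero.mpr (squeeze_zero (fun _ => dist_nonneg) (fun c' => ?_) h0)
  rw [Real.dist_eq]
  exact Real.abs_le_sqrt (ftrl_sub_sq_le hη hK c c' a)

/-- One step of the stability analysis: the optimal value moves at least by the loss of the
current weights minus a second order term. -/
lemma objective_ftrl_add_le (hη : 0 < η) (hK : 0 < K) (c l : Fin K → ℝ)
    (hl : ∀ a, η * |l a| ≤ 1 / 2) {p : Fin K → ℝ} (hp : p ∈ stdSimplex ℝ (Fin K)) :
    c ⬝ᵥ ftrl (1 / 2) η c + 1 / η * tsallis (1 / 2) (ftrl (1 / 2) η c) +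
        (l ⬝ᵥ ftrl (1 / 2) η c - 2 * η * ∑ a, ftrl (1 / 2) η c a * l a ^ 2) ≤
      (c + l) ⬝ᵥ p + 1 / η * tsallis (1 / 2) p := by
  have hq := isStationary_ftrl hη hK c
  set q := ftrl (1 / 2) η c
  have h1 := hq.objective_eq hη hp
  have key : ∀ a, l a * q a - 2 * η * (q a * l a ^ 2) ≤
      l a * p a + (√(p a) - √(q a)) ^ 2 / (η * √(q a)) := fun a => by
    have hv : 0 < √(q a) := Real.sqrt_pos.mpr (hq.pos a)
    have hv1 : √(q a) ≤ 1 := Real.sqrt_le_one.mpr (hq.le_one a)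
    have hq2 := Real.sq_sqrt (hq.pos a).le
    have hp2 := Real.sq_sqrt (hp.1 a)
    have hla := hl a
    rw [← abs_of_pos hη, ← abs_mul, abs_le] at hla
    generalize √(q a) = v at *
    generalize √(p a) = u at *
    rw [← hq2, ← hp2, ← sub_nonneg]
    have e : l a * u ^ 2 + (u - v) ^ 2 / (η * v) - (l a * v ^ 2 - 2 * η * (v ^ 2 * l a ^ 2)) =
        (η * l a * v * ((u - v) ^ 2 + 2 * v * (u - v)) + (u - v) ^ 2 +
          2 * (η * l a) ^ 2 * v ^ 3) / (η * v) := by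
      field_simp
      ring
    rw [e]
    refine div_nonneg ?_ (by positivity)
    set s := η * l a
    -- Completing the square with half of `(u - v) ^ 2`. The other half absorbs `s * v * (u - v) ^
    -- 2`, which is where `|s| ≤ 1 / 2` and `v ≤ 1` are used; `s` may be negative.
    have e2 : s * v * ((u - v) ^ 2 + 2 * v * (u - v)) + (u - v) ^ 2 + 2 * s ^ 2 * v ^ 3 =
        2 * ((u - v) / 2 + s * v ^ 2) ^ 2 + (u - v) ^ 2 * (1 / 2 + s * v) +
          2 * s ^ 2 * v ^ 3 * (1 - v) := by ring
    rw [e2]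
    have e3 : 0 ≤ 1 / 2 + s * v := by nlinarith
    have e4 : 0 ≤ 1 - v := by linarith
    positivity
  have h2 := Finset.sum_le_sum fun a (_ : a ∈ Finset.univ) => key a
  simp only [Finset.sum_sub_distrib, Finset.sum_add_distrib, ← Finset.mul_sum] at h2
  rw [add_dotProduct]
  change l ⬝ᵥ q - _ ≤ l ⬝ᵥ p + _ at h2
  linarith

lemma tsallis_half_nonpos {p : Fin K → ℝ} (hp : p ∈ stdSimplex ℝ (Fin K)) :
    tsallis (1 / 2) p ≤ 0 := by
  have h : ∑ a, p a ≤ ∑ a, √(p a) := Finset.sum_le_sum fun a _ => by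
    have h1 : p a ≤ 1 := hp.2 ▸ Finset.single_le_sum (f := p) (fun b _ => hp.1 b)
      (Finset.mem_univ a)
    exact Real.le_sqrt_of_sq_le (by nlinarith [hp.1 a])
  rw [hp.2] at h
  rw [tsallis_half]
  linarith

lemma neg_two_sqrt_le_tsallis_half {p : Fin K → ℝ} (hp : p ∈ stdSimplex ℝ (Fin K)) :
    -(2 * √(K : ℝ)) ≤ tsallis (1 / 2) p := by
  have h : (∑ a, √(p a)) ≤ √(K : ℝ) := by
    refine Real.le_sqrt_of_sq_le ?_
    have h1 := sq_sum_le_card_mul_sum_sq (s := Finset.univ) (f := fun a => √(p a))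
    simpa [Real.sq_sqrt (hp.1 _), hp.2] using h1
  rw [tsallis_half]
  linarith

/-- The regret of follow the regularized leader with the `1/2`-Tsallis entropy and nonincreasing
learning rates. -/
lemma sum_ftrl_le (hK : 0 < K) (η : ℕ → ℝ) (hη : ∀ t, 0 < η t)
    (hanti : Antitone η) (l : ℕ → Fin K → ℝ) (T : ℕ)
    (hl : ∀ t < T, ∀ a, η t * |l t a| ≤ 1 / 2) (b : Fin K) :
    ∑ t ∈ Finset.range T, (l t ⬝ᵥ ftrl (1 / 2) (η t) (∑ s ∈ Finset.range t, l s) - l t b) ≤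
      2 * √(K : ℝ) / η T + ∑ t ∈ Finset.range T,
        2 * η t * ∑ a, ftrl (1 / 2) (η t) (∑ s ∈ Finset.range t, l s) a * l t a ^ 2 := by
  let q : ℕ → Fin K → ℝ := fun t => ftrl (1 / 2) (η t) (∑ s ∈ Finset.range t, l s)
  have hq : ∀ t, IsStationary (η t) (∑ s ∈ Finset.range t, l s) (q t) := fun t =>
    isStationary_ftrl (hη t) hK _
  -- The potential is the optimal value after `n` losses at rate `η n`. Lowering the rate changes it
  -- by at most `2√K` times the increase of `1 / η`, and these costs telescope together with the
  -- initial one to `2√K / η n`.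
  have main : ∀ n ≤ T, ∑ t ∈ Finset.range n,
      (l t ⬝ᵥ q t - 2 * η t * ∑ a, q t a * l t a ^ 2) - 2 * √(K : ℝ) / η n ≤
      (∑ s ∈ Finset.range n, l s) ⬝ᵥ q n + 1 / η n * tsallis (1 / 2) (q n) := by
    intro n
    induction n with
    | zero =>
      intro _
      have h1 := neg_two_sqrt_le_tsallis_half (hq 0).mem_simplex
      have h2 : 0 < 1 / η 0 := one_div_pos.mpr (hη 0)
      simp only [Finset.range_zero, Finset.sum_empty, zero_dotProduct, zero_sub, zero_add]
      have : -(2 * √(K : ℝ) / η 0) = 1 / η 0 * -(2 * √(K : ℝ)) := by ring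
      rw [this]
      exact mul_le_mul_of_nonneg_left h1 h2.le
    | succ n ih =>
      intro hn
      have h1 := ih (by omega)
      have h2 := objective_ftrl_add_le (hη n) hK (∑ s ∈ Finset.range n, l s) (l n)
        (hl n (by omega)) (hq (n + 1)).mem_simplex
      rw [← Finset.sum_range_succ] at h2
      change (∑ s ∈ Finset.range n, l s) ⬝ᵥ q n + 1 / η n * tsallis (1 / 2) (q n) +
        (l n ⬝ᵥ q n - 2 * η n * ∑ a, q n a * l n a ^ 2) ≤ _ at h2
      have h3 := neg_two_sqrt_le_tsallis_half (hq (n + 1)).mem_simplex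
      have h4 : 1 / η n ≤ 1 / η (n + 1) :=
        one_div_le_one_div_of_le (hη _) (hanti (Nat.le_succ n))
      have h5 : (1 / η (n + 1) - 1 / η n) * -(2 * √(K : ℝ)) ≤
          (1 / η (n + 1) - 1 / η n) * tsallis (1 / 2) (q (n + 1)) :=
        mul_le_mul_of_nonneg_left h3 (by linarith)
      rw [Finset.sum_range_succ]
      have e1 : 2 * √(K : ℝ) / η n = 1 / η n * (2 * √(K : ℝ)) := by ring
      have e2 : 2 * √(K : ℝ) / η (n + 1) = 1 / η (n + 1) * (2 * √(K : ℝ)) := by ring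
      rw [e1] at h1
      rw [e2]
      nlinarith
  have h1 := main T le_rfl
  -- The optimal value is bounded above by that of the vertex of the comparator arm.
  have hb : Pi.single b (1 : ℝ) ∈ stdSimplex ℝ (Fin K) := single_mem_stdSimplex ℝ b
  have h2 := (hq T).objective_eq (hη T) hb
  have h3 : 0 ≤ ∑ a, (√((Pi.single b (1 : ℝ) : Fin K → ℝ) a) - √(q T a)) ^ 2 /
      (η T * √(q T a)) :=
    Finset.sum_nonneg fun a _ => by have := hη T; positivity
  have h4 : 1 / η T * tsallis (1 / 2) (Pi.single b (1 : ℝ) : Fin K → ℝ) ≤ 0 :=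
    mul_nonpos_of_nonneg_of_nonpos (one_div_pos.mpr (hη T)).le (tsallis_half_nonpos hb)
  have h5 : (∑ s ∈ Finset.range T, l s) ⬝ᵥ (Pi.single b (1 : ℝ) : Fin K → ℝ) =
      ∑ s ∈ Finset.range T, l s b := by
    rw [dotProduct_single, mul_one, Finset.sum_apply]
  rw [h5] at h2
  rw [Finset.sum_sub_distrib] at h1 ⊢
  change ∑ t ∈ Finset.range T, l t ⬝ᵥ q t - _ ≤ _ + ∑ t ∈ Finset.range T,
        2 * η t * ∑ a, q t a * l t a ^ 2
  linarith

end FTRL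

/-! ### Cauchy–Schwarz inequalities for positive definite matrices and their inverses. -/

section Matrix

variable {n : Type*} [Fintype n]

lemma sq_dotProduct_mulVec_le {N : Matrix n n ℝ} (hN : N.PosSemidef) (u v : n → ℝ) :
    (u ⬝ᵥ N.mulVec v) ^ 2 ≤ (u ⬝ᵥ N.mulVec u) * (v ⬝ᵥ N.mulVec v) := by
  classical
  have h := LinearMap.BilinForm.apply_sq_le_of_symm (Matrix.toBilin' N)
    (fun x => by simpa [Matrix.toBilin'_apply'] using hN.dotProduct_mulVec_nonneg x)
    ⟨fun x y => by
      simp only [Matrix.toBilin'_apply', RingHom.id_apply]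
      rw [dotProduct_comm, Matrix.dotProduct_mulVec, ← Matrix.mulVec_transpose]
      have := hN.isHermitian.eq
      rw [Matrix.conjTranspose_eq_transpose_of_trivial] at this
      rw [dotProduct_comm, this, dotProduct_comm]⟩ u v
  simpa only [Matrix.toBilin'_apply'] using h

variable [DecidableEq n]

lemma mulVec_inv_mulVec {N : Matrix n n ℝ} (hN : N.PosDef) (z : n → ℝ) :
    N.mulVec (N⁻¹.mulVec z) = z := by
  rw [Matrix.mulVec_mulVec,
    Matrix.mul_nonsing_inv _ ((Matrix.isUnit_iff_isUnit_det _).mp hN.isUnit), Matrix.one_mulVec]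

lemma sq_dotProduct_le_of_posDef {N : Matrix n n ℝ} (hN : N.PosDef) (u z : n → ℝ) :
    (u ⬝ᵥ z) ^ 2 ≤ (u ⬝ᵥ N.mulVec u) * (z ⬝ᵥ N⁻¹.mulVec z) := by
  have h := sq_dotProduct_mulVec_le hN.posSemidef u (N⁻¹.mulVec z)
  rwa [mulVec_inv_mulVec hN, dotProduct_comm (N⁻¹.mulVec z) z] at h

/-- Inversion reverses the Loewner order. With `w = M⁻¹ z` and `s = w ⬝ᵥ z = wᵀ M w`, Cauchy–Schwarz
for `N` gives `γ s² ≤ s (zᵀ N⁻¹ z)`, and one factor `s` cancels. -/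
lemma dotProduct_inv_mulVec_le {M N : Matrix n n ℝ} (hM : M.PosDef) (hN : N.PosDef) {γ r : ℝ}
    (hγ : 0 < γ) (hle : ∀ u, γ * (u ⬝ᵥ N.mulVec u) ≤ u ⬝ᵥ M.mulVec u) {z : n → ℝ}
    (hz : z ⬝ᵥ N⁻¹.mulVec z ≤ r) : z ⬝ᵥ M⁻¹.mulVec z ≤ r / γ := by
  have h1 := sq_dotProduct_le_of_posDef hN (M⁻¹.mulVec z) z
  have h2 := hle (M⁻¹.mulVec z)
  rw [mulVec_inv_mulVec hM] at h2
  rw [dotProduct_comm z]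
  have h3 : 0 ≤ M⁻¹.mulVec z ⬝ᵥ z := by
    rw [dotProduct_comm]
    simpa using hM.inv.posSemidef.dotProduct_mulVec_nonneg z
  have h4 : 0 ≤ z ⬝ᵥ N⁻¹.mulVec z := by
    simpa using hN.inv.posSemidef.dotProduct_mulVec_nonneg z
  set s := M⁻¹.mulVec z ⬝ᵥ z
  rw [le_div_iff₀ hγ]
  rcases h3.eq_or_lt with h | h
  · rw [← h, zero_mul]
    linarith
  · have h5 : γ * s ^ 2 ≤ s * (z ⬝ᵥ N⁻¹.mulVec z) := by nlinarith
    have h6 : γ * s ≤ z ⬝ᵥ N⁻¹.mulVec z := by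
      by_contra hcon
      nlinarith
    linarith

lemma abs_dotProduct_inv_mulVec_le {M : Matrix n n ℝ} (hM : M.PosDef) {r : ℝ} {z w : n → ℝ}
    (hz : z ⬝ᵥ M⁻¹.mulVec z ≤ r) (hw : w ⬝ᵥ M⁻¹.mulVec w ≤ r) : |z ⬝ᵥ M⁻¹.mulVec w| ≤ r := by
  have h1 := sq_dotProduct_mulVec_le hM.inv.posSemidef z w
  have h4 : 0 ≤ z ⬝ᵥ M⁻¹.mulVec z := by
    simpa using hM.inv.posSemidef.dotProduct_mulVec_nonneg z
  have h5 : 0 ≤ w ⬝ᵥ M⁻¹.mulVec w := by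
    simpa using hM.inv.posSemidef.dotProduct_mulVec_nonneg w
  refine abs_le_of_sq_le_sq (h1.trans ?_) (h4.trans hz)
  rw [sq]
  exact mul_le_mul hz hw h5 (h4.trans hz)

end Matrix

/-! ### Averages over the arms. -/

section Simplex

variable {𝒳 : Type*} [MeasurableSpace 𝒳] {K : ℕ}

lemma abs_sum_simplex_mul_le {p f : Fin K → ℝ} (hp : p ∈ stdSimplex ℝ (Fin K)) {C : ℝ}
    (hf : ∀ a, |f a| ≤ C) : |∑ a, p a * f a| ≤ C := by
  calc |∑ a, p a * f a| ≤ ∑ a, |p a * f a| := Finset.abs_sum_le_sum_abs _ _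
    _ ≤ ∑ a, p a * C := Finset.sum_le_sum fun a _ => by
        rw [abs_mul, abs_of_nonneg (hp.1 a)]
        exact mul_le_mul_of_nonneg_left (hf a) (hp.1 a)
    _ = C := by rw [← Finset.sum_mul, hp.2, one_mul]

lemma integrable_sum_simplex_mul {G : Measure 𝒳} [IsFiniteMeasure G] {p : 𝒳 → Fin K → ℝ}
    (hpm : Measurable p) (hp : ∀ x, p x ∈ stdSimplex ℝ (Fin K)) {f : Fin K → 𝒳 → ℝ}
    (hfm : ∀ a, Measurable (f a)) {C : ℝ} (hf : ∀ a x, |f a x| ≤ C) :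
    Integrable (fun x => ∑ a, p x a * f a x) G := by
  refine Integrable.of_bound (C := C) ?_ (Filter.Eventually.of_forall fun x => ?_)
  · exact (Finset.measurable_sum _ fun a _ =>
      ((measurable_pi_apply a).comp hpm).mul (hfm a)).aestronglyMeasurable
  · exact abs_sum_simplex_mul_le (hp x) fun a => hf a x

end Simplex

/-! ### The matrix `Σ(p)`: quadratic forms, domination, trace identity. -/

section Cov

variable {𝒳 : Type*} [MeasurableSpace 𝒳] {K d : ℕ} {G : Measure 𝒳}
  {φ : Fin K → 𝒳 → Fin d → ℝ} {p : 𝒳 → Fin K → ℝ} {𝒵 : Set (Fin d → ℝ)} {lam : ℝ}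
  {e : 𝒳 → Fin K → ℝ}

lemma isHermitian_cov : (cov G φ p).IsHermitian := by
  ext i j
  simp only [cov, Matrix.conjTranspose_apply, Matrix.of_apply, star_trivial]
  exact integral_congr_ae (Filter.Eventually.of_forall fun x =>
    Finset.sum_congr rfl fun a _ => by ring)

/-- Cauchy–Schwarz against the basis vector `e_i` bounds the squared coordinate by `Σ(e)_ii / lam`.
The feature space is not assumed bounded; this bound is the source of integrability for feature
averages. -/
lemma IsExploration.exists_bound (he : IsExploration G φ 𝒵 lam e) (hmem : ∀ a x, φ a x ∈ 𝒵) :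
    ∃ B, ∀ a x i, |φ a x i| ≤ B := by
  refine ⟨∑ i, √((cov G φ e) i i * (1 / lam)), fun a x i => ?_⟩
  have h1 := sq_dotProduct_le_of_posDef he.posDef (Pi.single i 1) (φ a x)
  have h2 := he.quad_le _ (hmem a x)
  have h3 : 0 ≤ Pi.single i 1 ⬝ᵥ (cov G φ e).mulVec (Pi.single i 1) := by
    simpa using he.posDef.posSemidef.dotProduct_mulVec_nonneg (Pi.single i 1)
  have h4 := h1.trans (mul_le_mul_of_nonneg_left h2 h3)
  simp only [single_dotProduct, one_mul, Matrix.mulVec_single_one, Matrix.col_apply] at h4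
  exact (Real.abs_le_sqrt h4).trans (Finset.single_le_sum
    (f := fun i => √((cov G φ e) i i * (1 / lam))) (fun _ _ => Real.sqrt_nonneg _)
    (Finset.mem_univ i))

lemma integral_sum_sum_mul (N : Fin d → Fin d → ℝ) {f : Fin d → Fin d → 𝒳 → ℝ}
    (hf : ∀ i j, Integrable (f i j) G) :
    ∫ x, ∑ i, ∑ j, N i j * f i j x ∂G = ∑ i, ∑ j, N i j * ∫ x, f i j x ∂G := by
  rw [integral_finsetSum _ fun i _ => integrable_finsetSum _ fun j _ => (hf i j).const_mul _]
  refine Finset.sum_congr rfl fun i _ => ?_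
  rw [integral_finsetSum _ fun j _ => (hf i j).const_mul _]
  exact Finset.sum_congr rfl fun j _ => integral_const_mul _ _

variable [IsProbabilityMeasure G]

lemma measurable_dotProduct_const {β : Type*} [MeasurableSpace β] {f : β → Fin d → ℝ}
    (hf : Measurable f) (u : Fin d → ℝ) : Measurable fun x => f x ⬝ᵥ u :=
  Finset.measurable_sum _ fun i _ => ((measurable_pi_apply i).comp hf).mul_const _

lemma abs_dotProduct_le_sum {z u : Fin d → ℝ} {B : ℝ} (hz : ∀ i, |z i| ≤ B) :
    |z ⬝ᵥ u| ≤ B * ∑ i, |u i| := by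
  rw [Finset.mul_sum]
  refine (Finset.abs_sum_le_sum_abs _ _).trans (Finset.sum_le_sum fun i _ => ?_)
  rw [abs_mul]
  exact mul_le_mul_of_nonneg_right (hz i) (abs_nonneg _)

lemma integrable_cov_entry (hφ : ∀ a, Measurable (φ a)) {B : ℝ} (hB : ∀ a x i, |φ a x i| ≤ B)
    (hpm : Measurable p) (hp : ∀ x, p x ∈ stdSimplex ℝ (Fin K)) (i j : Fin d) :
    Integrable (fun x => ∑ a, p x a * (φ a x i * φ a x j)) G := by
  refine integrable_sum_simplex_mul (C := B * B) hpm hp (fun a => ?_) fun a x => ?_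
  · exact ((measurable_pi_apply i).comp (hφ a)).mul ((measurable_pi_apply j).comp (hφ a))
  · rw [abs_mul]
    exact mul_le_mul (hB a x i) (hB a x j) (abs_nonneg _) ((abs_nonneg _).trans (hB a x i))

lemma integrable_quad (hφ : ∀ a, Measurable (φ a)) {B : ℝ} (hB : ∀ a x i, |φ a x i| ≤ B)
    (hpm : Measurable p) (hp : ∀ x, p x ∈ stdSimplex ℝ (Fin K)) (u v : Fin d → ℝ) :
    Integrable (fun x => ∑ a, p x a * ((φ a x ⬝ᵥ u) * (φ a x ⬝ᵥ v))) G := by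
  refine integrable_sum_simplex_mul (C := (B * ∑ i, |u i|) * (B * ∑ i, |v i|)) hpm hp
    (fun a => ?_) fun a x => ?_
  · exact (measurable_dotProduct_const (hφ a) u).mul (measurable_dotProduct_const (hφ a) v)
  · rw [abs_mul]
    exact mul_le_mul (abs_dotProduct_le_sum (hB a x)) (abs_dotProduct_le_sum (hB a x))
      (abs_nonneg _) ((abs_nonneg _).trans (abs_dotProduct_le_sum (hB a x)))

lemma dotProduct_cov_mulVec (hφ : ∀ a, Measurable (φ a)) {B : ℝ} (hB : ∀ a x i, |φ a x i| ≤ B)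
    (hpm : Measurable p) (hp : ∀ x, p x ∈ stdSimplex ℝ (Fin K)) (u v : Fin d → ℝ) :
    u ⬝ᵥ (cov G φ p).mulVec v = ∫ x, ∑ a, p x a * ((φ a x ⬝ᵥ u) * (φ a x ⬝ᵥ v)) ∂G := by
  have h : ∀ x, ∑ a, p x a * ((φ a x ⬝ᵥ u) * (φ a x ⬝ᵥ v)) =
      ∑ i, ∑ j, u i * v j * ∑ a, p x a * (φ a x i * φ a x j) := fun x => by
    simp only [dotProduct, Finset.sum_mul_sum]
    simp only [Finset.mul_sum]
    rw [Finset.sum_comm]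
    refine Finset.sum_congr rfl fun i _ => ?_
    rw [Finset.sum_comm]
    exact Finset.sum_congr rfl fun j _ => Finset.sum_congr rfl fun a _ => by ring
  simp only [h]
  refine Eq.symm ((integral_sum_sum_mul (fun i j => u i * v j)
    (fun i j => integrable_cov_entry (G := G) hφ hB hpm hp i j)).trans ?_)
  simp only [dotProduct, Matrix.mulVec, Finset.mul_sum]
  refine Finset.sum_congr rfl fun i _ => Finset.sum_congr rfl fun j _ => ?_
  simp only [cov, Matrix.of_apply]
  ring

/-- Dominance of the conditional distributions carries over to the quadratic forms. -/
lemma mul_dotProduct_cov_mulVec_le (hφ : ∀ a, Measurable (φ a)) {B : ℝ}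
    (hB : ∀ a x i, |φ a x i| ≤ B) (hpm : Measurable p) (hp : ∀ x, p x ∈ stdSimplex ℝ (Fin K))
    (hem : Measurable e) (he : ∀ x, e x ∈ stdSimplex ℝ (Fin K)) {γ : ℝ}
    (hle : ∀ x a, γ * e x a ≤ p x a) (u : Fin d → ℝ) :
    γ * (u ⬝ᵥ (cov G φ e).mulVec u) ≤ u ⬝ᵥ (cov G φ p).mulVec u := by
  rw [dotProduct_cov_mulVec hφ hB hpm hp, dotProduct_cov_mulVec hφ hB hem he,
    ← integral_const_mul]
  refine integral_mono ((integrable_quad (G := G) hφ hB hem he u u).const_mul _)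
    (integrable_quad (G := G) hφ hB hpm hp u u) fun x => ?_
  simp only [Finset.mul_sum]
  refine Finset.sum_le_sum fun a _ => ?_
  rw [← mul_assoc]
  exact mul_le_mul_of_nonneg_right (hle x a) (mul_self_nonneg _)

lemma posDef_cov_of_le (hφ : ∀ a, Measurable (φ a)) {B : ℝ}
    (hB : ∀ a x i, |φ a x i| ≤ B) (hpm : Measurable p) (hp : ∀ x, p x ∈ stdSimplex ℝ (Fin K))
    (hem : Measurable e) (he : ∀ x, e x ∈ stdSimplex ℝ (Fin K)) {γ : ℝ}
    (hγ : 0 < γ) (hle : ∀ x a, γ * e x a ≤ p x a) (hpos : (cov G φ e).PosDef) :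
    (cov G φ p).PosDef := by
  refine Matrix.PosDef.of_dotProduct_mulVec_pos (isHermitian_cov (G := G)) fun u hu => ?_
  have h1 := mul_dotProduct_cov_mulVec_le (G := G) hφ hB hpm hp hem he hle u
  have h2 := hpos.dotProduct_mulVec_pos hu
  rw [star_trivial] at h2 ⊢
  exact (mul_pos hγ h2).trans_le h1

/-- The integral is the trace of `Σ(p)⁻¹ Σ(p)`. -/
lemma integral_dotProduct_cov_inv_mulVec (hφ : ∀ a, Measurable (φ a)) {B : ℝ}
    (hB : ∀ a x i, |φ a x i| ≤ B) (hpm : Measurable p) (hp : ∀ x, p x ∈ stdSimplex ℝ (Fin K))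
    (hpos : (cov G φ p).PosDef) :
    ∫ x, ∑ a, p x a * (φ a x ⬝ᵥ (cov G φ p)⁻¹.mulVec (φ a x)) ∂G = d := by
  set M := cov G φ p with hM
  have h : ∀ x, ∑ a, p x a * (φ a x ⬝ᵥ M⁻¹.mulVec (φ a x)) =
      ∑ i, ∑ j, M⁻¹ i j * ∑ a, p x a * (φ a x j * φ a x i) := fun x => by
    simp only [dotProduct, Matrix.mulVec, Finset.mul_sum]
    rw [Finset.sum_comm]
    refine Finset.sum_congr rfl fun i _ => ?_
    rw [Finset.sum_comm]
    exact Finset.sum_congr rfl fun j _ => Finset.sum_congr rfl fun a _ => by ring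
  simp only [h]
  refine (integral_sum_sum_mul (fun i j => M⁻¹ i j)
    (fun i j => integrable_cov_entry (G := G) hφ hB hpm hp j i)).trans ?_
  have h2 : ∀ i, ∑ j, M⁻¹ i j * ∫ x, ∑ a, p x a * (φ a x j * φ a x i) ∂G = (M⁻¹ * M) i i :=
    fun i => by
      rw [Matrix.mul_apply, hM]
      simp only [cov, Matrix.of_apply]
  simp only [h2, Matrix.nonsing_inv_mul _ ((Matrix.isUnit_iff_isUnit_det _).mp hpos.isUnit),
    Matrix.one_apply_eq]
  simp

/-- A probability space has a point, and the simplex over no arms is empty. -/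
lemma IsExploration.pos_arms (he : IsExploration G φ 𝒵 lam e) : 0 < K := by
  obtain ⟨x⟩ := G.nonempty_of_neZero
  rcases Nat.eq_zero_or_pos K with h | h
  · subst h
    simpa using (he.mem_simplex x).2
  · exact h

/-- The mean of `φᵀ Σ(e)⁻¹ φ` under `e` is `d`, yet it is bounded pointwise by `1 / lam`. -/
lemma IsExploration.lam_mul_dim_le (he : IsExploration G φ 𝒵 lam e) (hφ : ∀ a, Measurable (φ a))
    (hmem : ∀ a x, φ a x ∈ 𝒵) : lam * d ≤ 1 := by
  obtain ⟨B, hB⟩ := he.exists_bound hmem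
  rw [← integral_dotProduct_cov_inv_mulVec hφ hB he.measurable he.mem_simplex he.posDef]
  have h : ∫ x, ∑ a, e x a * (φ a x ⬝ᵥ (cov G φ e)⁻¹.mulVec (φ a x)) ∂G ≤ ∫ _, 1 / lam ∂G := by
    refine integral_mono_of_nonneg (Filter.Eventually.of_forall fun x => ?_)
      (integrable_const _) (Filter.Eventually.of_forall fun x => ?_)
    · refine Finset.sum_nonneg fun a _ => mul_nonneg ((he.mem_simplex x).1 a) ?_
      simpa using he.posDef.inv.posSemidef.dotProduct_mulVec_nonneg (φ a x)
    · calc _ ≤ ∑ a, e x a * (1 / lam) := Finset.sum_le_sum fun a _ =>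
            mul_le_mul_of_nonneg_left (he.quad_le _ (hmem a x)) ((he.mem_simplex x).1 a)
        _ = 1 / lam := by rw [← Finset.sum_mul, (he.mem_simplex x).2, one_mul]
  have hl := he.lam_pos
  calc _ ≤ lam * (1 / lam) := mul_le_mul_of_nonneg_left (by simpa using h) hl.le
    _ = 1 := by field_simp

end Cov

/-! ### Learning and exploration rates. -/

section Rates

variable {K d : ℕ} {lam : ℝ}

lemma learningRate_pos (hK : 0 < K) (hd : 1 ≤ d) (hl : 0 < lam) (t : ℕ) :
    0 < learningRate K d lam t := by
  unfold learningRate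
  split_ifs with h
  · positivity
  · have h1 : (0 : ℝ) < K := by exact_mod_cast hK
    have h2 : (0 : ℝ) < d := by exact_mod_cast hd
    have h3 : (0 : ℝ) < t := by exact_mod_cast Nat.pos_of_ne_zero h
    exact lt_min (by positivity) (by positivity)

lemma learningRate_le (t : ℕ) : learningRate K d lam t ≤ lam / 16 := by
  unfold learningRate
  split_ifs
  · rfl
  · exact min_le_right _ _

lemma antitone_learningRate (hd : 1 ≤ d) : Antitone (learningRate K d lam) := by
  refine antitone_nat_of_succ_le fun t => ?_
  rcases Nat.eq_zero_or_pos t with h | h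
  · subst h
    exact (learningRate_le 1).trans (by simp [learningRate])
  · have h2 : (0 : ℝ) < d := by exact_mod_cast hd
    have h3 : (0 : ℝ) < t := by exact_mod_cast h
    simp only [learningRate, Nat.succ_ne_zero, h.ne', if_false]
    refine min_le_min_right _ ?_
    gcongr
    simp

/-- The weights of a round use the previous learning rate but its exploration uses the current one;
this comparison lets the current exploration control the stability of the former. -/
lemma learningRate_pred_le (hK : 0 < K) (hd : 1 ≤ d) (hl : 0 < lam) (hld : lam * d ≤ 1)
    (t : ℕ) : learningRate K d lam t ≤ 2 * learningRate K d lam (t + 1) := by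
  have hd' : (1 : ℝ) ≤ d := by exact_mod_cast hd
  have hK' : (1 : ℝ) ≤ (K : ℝ) ^ (1 / 4 : ℝ) :=
    Real.one_le_rpow (by exact_mod_cast hK) (by norm_num)
  have h := learningRate_le (K := K) (d := d) (lam := lam) t
  rcases Nat.eq_zero_or_pos t with ht | ht
  · subst ht
    -- Since `lam * √d ≤ lam * d ≤ 1`, the cap is still active at `t = 1`, so the first two rates
    -- coincide.
    have h1 : lam / 16 ≤ (K : ℝ) ^ (1 / 4 : ℝ) / √((d : ℝ) * ((0 + 1 : ℕ) : ℝ)) := by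
      have h2 : √((d : ℝ) * ((0 + 1 : ℕ) : ℝ)) ≤ d := by
        refine Real.sqrt_le_iff.mpr ⟨by positivity, ?_⟩
        push_cast
        nlinarith
      rw [le_div_iff₀ (by positivity)]
      have h5 := mul_le_mul_of_nonneg_left h2 hl.le
      generalize √((d : ℝ) * ((0 + 1 : ℕ) : ℝ)) = s at *
      linarith
    have h3 : learningRate K d lam (0 + 1) = lam / 16 := by
      rw [learningRate, if_neg (by omega)]
      exact min_eq_right h1
    rw [h3]
    linarith
  · have h3 : (1 : ℝ) ≤ t := by exact_mod_cast ht
    simp only [learningRate, Nat.succ_ne_zero, ht.ne', if_false]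
    rw [mul_min_of_nonneg _ _ zero_le_two]
    refine min_le_min ?_ (by linarith)
    have h4 : √((d : ℝ) * ((t + 1 : ℕ) : ℝ)) ≤ 2 * √((d : ℝ) * t) := by
      refine Real.sqrt_le_iff.mpr ⟨by positivity, ?_⟩
      rw [mul_pow, Real.sq_sqrt (by positivity)]
      push_cast
      nlinarith
    rw [div_le_iff₀ (by positivity), mul_div_assoc', div_mul_eq_mul_div,
      le_div_iff₀ (by positivity)]
    nlinarith

lemma explorationRate_pos (hK : 0 < K) (hd : 1 ≤ d) (hl : 0 < lam) (t : ℕ) :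
    0 < explorationRate K d lam t := by
  have := learningRate_pos hK hd hl t
  unfold explorationRate
  positivity

lemma explorationRate_le_half (hl : 0 < lam) (t : ℕ) : explorationRate K d lam t ≤ 1 / 2 := by
  have := learningRate_le (K := K) (d := d) (lam := lam) t
  unfold explorationRate
  rw [div_le_iff₀ hl]
  linarith

end Rates

/-! ### The played mixture: lower bounds and measurability. -/

section Policy

variable {𝒳 : Type*} {K d : ℕ} {φ : Fin K → 𝒳 → Fin d → ℝ} {lam : ℝ} {e : 𝒳 → Fin K → ℝ}

lemma weights_mem_simplex (hK : 0 < K) (hd : 1 ≤ d) (hl : 0 < lam) (t : ℕ) (S : Fin d → ℝ)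
    (x : 𝒳) : weights (1 / 2) φ lam t S x ∈ stdSimplex ℝ (Fin K) :=
  (isStationary_ftrl (learningRate_pos hK hd hl _) hK _).mem_simplex

lemma policy_apply (t : ℕ) (S : Fin d → ℝ) (x : 𝒳) (a : Fin K) :
    policy (1 / 2) φ lam e t S x a = (1 - explorationRate K d lam t) *
      weights (1 / 2) φ lam t S x a + explorationRate K d lam t * e x a := rfl

lemma policy_mem_simplex (hK : 0 < K) (hd : 1 ≤ d) (hl : 0 < lam)
    (he : ∀ x, e x ∈ stdSimplex ℝ (Fin K)) (t : ℕ) (S : Fin d → ℝ) (x : 𝒳) :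
    policy (1 / 2) φ lam e t S x ∈ stdSimplex ℝ (Fin K) := by
  have h1 := explorationRate_pos hK hd hl t
  have h2 := explorationRate_le_half (K := K) (d := d) hl t
  exact convex_stdSimplex ℝ (Fin K) (weights_mem_simplex hK hd hl t S x) (he x) (by linarith)
    h1.le (by ring)

lemma explorationRate_mul_le_policy (hK : 0 < K) (hd : 1 ≤ d) (hl : 0 < lam) (t : ℕ)
    (S : Fin d → ℝ) (x : 𝒳) (a : Fin K) :
    explorationRate K d lam t * e x a ≤ policy (1 / 2) φ lam e t S x a := by
  have h2 := explorationRate_le_half (K := K) (d := d) hl t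
  rw [policy_apply]
  nlinarith [(weights_mem_simplex (φ := φ) hK hd hl t S x).1 a]

lemma half_mul_weights_le_policy (hK : 0 < K) (hd : 1 ≤ d) (hl : 0 < lam)
    (he : ∀ x, e x ∈ stdSimplex ℝ (Fin K)) (t : ℕ) (S : Fin d → ℝ) (x : 𝒳) (a : Fin K) :
    1 / 2 * weights (1 / 2) φ lam t S x a ≤ policy (1 / 2) φ lam e t S x a := by
  have h1 := explorationRate_pos hK hd hl t
  have h2 := explorationRate_le_half (K := K) (d := d) hl t
  rw [policy_apply]
  nlinarith [(weights_mem_simplex (φ := φ) hK hd hl t S x).1 a, (he x).1 a]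

variable [MeasurableSpace 𝒳]

lemma measurable_weights (hK : 0 < K) (hd : 1 ≤ d) (hl : 0 < lam) (hφ : ∀ a, Measurable (φ a))
    (t : ℕ) (a : Fin K) {β : Type*} [MeasurableSpace β] {S : β → Fin d → ℝ}
    {ξ : β → 𝒳} (hS : Measurable S) (hξ : Measurable ξ) :
    Measurable fun b => weights (1 / 2) φ lam t (S b) (ξ b) a := by
  have h1 : Measurable fun c : Fin K → ℝ => ftrl (1 / 2) (learningRate K d lam (t - 1)) c a :=
    measurable_pi_iff.mp (continuous_ftrl (learningRate_pos hK hd hl (t - 1)) hK).measurable a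
  have h2 : Measurable fun b => fun a => S b ⬝ᵥ φ a (ξ b) :=
    measurable_pi_lambda _ fun a => Finset.measurable_sum _ fun i _ =>
      ((measurable_pi_apply i).comp hS).mul ((measurable_pi_apply i).comp ((hφ a).comp hξ))
  have h3 := h1.comp h2
  exact h3

lemma measurable_policy (hK : 0 < K) (hd : 1 ≤ d) (hl : 0 < lam) (hφ : ∀ a, Measurable (φ a))
    (he : Measurable e) (t : ℕ) (a : Fin K) {β : Type*} [MeasurableSpace β] {S : β → Fin d → ℝ}
    {ξ : β → 𝒳} (hS : Measurable S) (hξ : Measurable ξ) :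
    Measurable fun b => policy (1 / 2) φ lam e t (S b) (ξ b) a := by
  have h1 : Measurable fun b => weights (1 / 2) φ lam t (S b) (ξ b) a :=
    measurable_weights hK hd hl hφ t a hS hξ
  have h2 : Measurable fun b => e (ξ b) a := (measurable_pi_apply a).comp (he.comp hξ)
  simp only [policy_apply]
  exact (h1.const_mul _).add (h2.const_mul _)

end Policy

/-- The inverse is `det⁻¹` times the adjugate also for singular matrices, where both conventions
give zero, so no invertibility is needed. -/
lemma measurable_matrix_inv_apply {β : Type*} [MeasurableSpace β] {d : ℕ}
    {f : β → Matrix (Fin d) (Fin d) ℝ} (hf : ∀ i j, Measurable fun b => f b i j) (i j : Fin d) :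
    Measurable fun b => (f b)⁻¹ i j := by
  have h : Measurable fun b => (fun i j => f b i j : Fin d → Fin d → ℝ) :=
    measurable_pi_lambda _ fun i => measurable_pi_lambda _ fun j => hf i j
  have h1 : Continuous fun M : Fin d → Fin d → ℝ => (Matrix.of M).det :=
    Continuous.matrix_det (A := fun M : Fin d → Fin d → ℝ => Matrix.of M) continuous_id
  have h2 : Continuous fun M : Fin d → Fin d → ℝ => (Matrix.of M).adjugate i j :=
    (Continuous.matrix_adjugate (A := fun M : Fin d → Fin d → ℝ => Matrix.of M)
      continuous_id).matrix_elem i j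
  have h3 := (h1.measurable.comp h).inv.mul (h2.measurable.comp h)
  have h4 : (fun b => (f b)⁻¹ i j) = fun b => ((f b).det)⁻¹ * (f b).adjugate i j := by
    ext b
    rw [Matrix.inv_def, Ring.inverse_eq_inv', Matrix.smul_apply, smul_eq_mul]
  rw [h4]
  exact h3

/-! ### Measurability of the estimates with respect to the history. -/

section Estimates

variable {𝒳 : Type*} [MeasurableSpace 𝒳] {K d : ℕ} {G : Measure 𝒳} [IsProbabilityMeasure G]
  {φ : Fin K → 𝒳 → Fin d → ℝ} {lam : ℝ} {e : 𝒳 → Fin K → ℝ}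

lemma measurable_cov_policy_apply (hK : 0 < K) (hd : 1 ≤ d) (hl : 0 < lam)
    (hφ : ∀ a, Measurable (φ a)) (he : Measurable e) (t : ℕ) (i j : Fin d) :
    Measurable fun S => cov G φ (policy (1 / 2) φ lam e t S) i j := by
  have h : Measurable fun p : (Fin d → ℝ) × 𝒳 =>
      ∑ a, policy (1 / 2) φ lam e t p.1 p.2 a * (φ a p.2 i * φ a p.2 j) :=
    Finset.measurable_sum _ fun a _ =>
      (measurable_policy hK hd hl hφ he t a measurable_fst measurable_snd).mul
        (((measurable_pi_apply i).comp ((hφ a).comp measurable_snd)).mul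
          ((measurable_pi_apply j).comp ((hφ a).comp measurable_snd)))
  exact (h.stronglyMeasurable.integral_prod_right' (ν := G)).measurable

lemma measurable_cov_policy_inv_mulVec (hK : 0 < K) (hd : 1 ≤ d) (hl : 0 < lam)
    (hφ : ∀ a, Measurable (φ a)) (he : Measurable e) (t : ℕ) {β : Type*} [MeasurableSpace β]
    {S z : β → Fin d → ℝ} (hS : Measurable S) (hz : Measurable z) :
    Measurable fun b => (cov G φ (policy (1 / 2) φ lam e t (S b)))⁻¹.mulVec (z b) := by
  refine measurable_pi_lambda _ fun i => ?_
  simp only [Matrix.mulVec, dotProduct]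
  refine Finset.measurable_sum _ fun j _ => ?_
  exact (measurable_matrix_inv_apply (fun i j =>
    (measurable_cov_policy_apply hK hd hl hφ he t i j).comp hS) i j).mul
      ((measurable_pi_apply j).comp hz)

lemma measurable_features (hφ : ∀ a, Measurable (φ a)) :
    Measurable fun p : 𝒳 × Fin K => φ p.2 p.1 :=
  measurable_from_prod_countable_left fun a => hφ a

lemma measurable_thetaHat (hK : 0 < K) (hd : 1 ≤ d) (hl : 0 < lam)
    (hφ : ∀ a, Measurable (φ a)) (he : Measurable e) (t : ℕ) :
    Measurable fun p : (Fin d → ℝ) × 𝒳 × Fin K × ℝ =>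
      thetaHat (1 / 2) G φ lam e t p.1 p.2.1 p.2.2.1 p.2.2.2 := by
  have h0 : Measurable fun p : (Fin d → ℝ) × 𝒳 × Fin K × ℝ => (p.2.1, p.2.2.1) :=
    (measurable_fst.comp measurable_snd).prodMk
      (measurable_fst.comp (measurable_snd.comp measurable_snd))
  have h1 : Measurable fun p : (Fin d → ℝ) × 𝒳 × Fin K × ℝ => p.2.2.2 :=
    measurable_snd.comp (measurable_snd.comp measurable_snd)
  have h2 : Measurable fun p : (Fin d → ℝ) × 𝒳 × Fin K × ℝ =>
      (cov G φ (policy (1 / 2) φ lam e t p.1))⁻¹.mulVec (φ p.2.2.1 p.2.1) :=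
    measurable_cov_policy_inv_mulVec (G := G) hK hd hl hφ he t measurable_fst
      ((measurable_features hφ).comp h0)
  unfold thetaHat
  exact h1.smul h2

variable {Ω : Type*} {X : ℕ → Ω → 𝒳} {A : ℕ → Ω → Fin K} {θ : ℕ → Ω → Fin d → ℝ}
  {ε : ℕ → Ω → Fin K → ℝ}

/-- The sum of the estimates of rounds `1, …, t` along a run. -/
def runEstimate (G : Measure 𝒳) (φ : Fin K → 𝒳 → Fin d → ℝ) (lam : ℝ) (e : 𝒳 → Fin K → ℝ)
    (X : ℕ → Ω → 𝒳) (A : ℕ → Ω → Fin K) (θ : ℕ → Ω → Fin d → ℝ) (ε : ℕ → Ω → Fin K → ℝ)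
    (t : ℕ) (ω : Ω) : Fin d → ℝ :=
  cumEstimate (1 / 2) G φ lam e (fun s => X s ω) (fun s => A s ω)
    (fun s => loss φ θ ε s (A s ω) (X s ω) ω) t

lemma history_mono {s t : ℕ} (h : s ≤ t) : history φ X A θ ε s ≤ history φ X A θ ε t :=
  biSup_mono fun r hr => by
    rw [Finset.mem_Ico] at hr ⊢
    omega

lemma measurable_runEstimate (hK : 0 < K) (hd : 1 ≤ d) (hl : 0 < lam)
    (hφ : ∀ a, Measurable (φ a)) (he : Measurable e) (t : ℕ) :
    Measurable[history φ X A θ ε (t + 1)] (runEstimate G φ lam e X A θ ε t) := by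
  induction t with
  | zero => exact measurable_const
  | succ t ih =>
    -- `history (t + 1)` records the rounds up to `t`, hence the shift by one.
    have h1 : Measurable[history φ X A θ ε (t + 1 + 1)] (runEstimate G φ lam e X A θ ε t) :=
      ih.mono (history_mono (by omega)) le_rfl
    have h2 : Measurable[history φ X A θ ε (t + 1 + 1)] fun ω =>
        (X (t + 1) ω, A (t + 1) ω, loss φ θ ε (t + 1) (A (t + 1) ω) (X (t + 1) ω) ω) :=
      (comap_measurable _).mono (le_biSup (f := fun s => MeasurableSpace.comap
        (fun ω => (X s ω, A s ω, loss φ θ ε s (A s ω) (X s ω) ω)) inferInstance)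
        (Finset.mem_Ico.mpr ⟨by omega, by omega⟩)) le_rfl
    exact h1.add ((measurable_thetaHat hK hd hl hφ he (t + 1)).comp (h1.prodMk h2))

end Estimates

/-! ### Conditioning tools: pulling out known factors, drawing an arm, drawing a context. -/

section General

variable {Ω : Type*} {m mΩ : MeasurableSpace Ω} {P : Measure Ω} [IsProbabilityMeasure P]

lemma integral_mul_eq_integral_mul_condExp (hm : m ≤ mΩ) {f g : Ω → ℝ} (hf : Measurable[m] f)
    {C : ℝ} (hC : ∀ᵐ ω ∂P, |f ω| ≤ C) (hg : Integrable g P) {g' : Ω → ℝ}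
    (hg' : P[g | m] =ᵐ[P] g') :
    Integrable (fun ω => f ω * g' ω) P ∧ ∫ ω, f ω * g ω ∂P = ∫ ω, f ω * g' ω ∂P := by
  have hfg : Integrable (f * g) P :=
    hg.bdd_mul (hf.mono hm le_rfl).aestronglyMeasurable hC
  have h1 := condExp_mul_of_stronglyMeasurable_left hf.stronglyMeasurable hfg hg
  have h2 : P[f * g | m] =ᵐ[P] fun ω => f ω * g' ω := by
    filter_upwards [h1, hg'] with ω h3 h4
    rw [h3, Pi.mul_apply, h4]
  refine ⟨integrable_condExp.congr h2, ?_⟩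
  rw [← integral_congr_ae h2, integral_condExp hm]
  rfl

/-- The expectation over an arm that is drawn from `π` given `m`. -/
lemma integral_comp_arm (hm : m ≤ mΩ) {K : ℕ} {A : Ω → Fin K} (hA : Measurable A)
    {π : Fin K → Ω → ℝ}
    (hπ : ∀ a, P[(A ⁻¹' {a}).indicator (fun _ => (1 : ℝ)) | m] =ᵐ[P] π a)
    {f : Fin K → Ω → ℝ} (hf : ∀ a, Measurable[m] (f a)) {C : ℝ}
    (hC : ∀ᵐ ω ∂P, ∀ a, |f a ω| ≤ C) :
    ∫ ω, f (A ω) ω ∂P = ∫ ω, ∑ a, π a ω * f a ω ∂P := by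
  have hind : ∀ a, Integrable ((A ⁻¹' {a}).indicator (fun _ => (1 : ℝ))) P := fun a =>
    (integrable_const _).indicator (hA (measurableSet_singleton a))
  have hC' : ∀ a, ∀ᵐ ω ∂P, |f a ω| ≤ C := ae_all_iff.mp hC
  have h := fun a => integral_mul_eq_integral_mul_condExp hm (hf a) (hC' a) (hind a) (hπ a)
  have h1 : ∀ ω, f (A ω) ω = ∑ a, f a ω * (A ⁻¹' {a}).indicator (fun _ => (1 : ℝ)) ω := fun ω => by
    rw [Finset.sum_eq_single (A ω)]
    · simp
    · intro b _ hb
      rw [Set.indicator_of_notMem (by simpa using hb.symm), mul_zero]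
    · simp
  simp only [h1, mul_comm (π _ _)]
  rw [integral_finsetSum _ fun a _ => (h a).1, integral_finsetSum]
  · exact Finset.sum_congr rfl fun a _ => (h a).2
  · exact fun a _ => (hind a).bdd_mul ((hf a).mono hm le_rfl).aestronglyMeasurable (hC' a)

lemma integral_mul_eq_zero_of_condExp (hm : m ≤ mΩ) {f g : Ω → ℝ} (hf : Measurable[m] f)
    {C : ℝ} (hC : ∀ᵐ ω ∂P, |f ω| ≤ C) (hg : Integrable g P) (hg' : P[g | m] =ᵐ[P] 0) :
    ∫ ω, f ω * g ω ∂P = 0 := by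
  rw [(integral_mul_eq_integral_mul_condExp hm hf hC hg hg').2]
  simp

/-- The expectation over a context with law `G` that is independent of `m`. -/
lemma integral_comp_context {𝒳 β : Type*} [MeasurableSpace 𝒳] [MeasurableSpace β] (hm : m ≤ mΩ)
    {G : Measure 𝒳} {X : Ω → 𝒳} (hX : Measurable X) (hG : P.map X = G)
    (hind : ProbabilityTheory.Indep (MeasurableSpace.comap X inferInstance) m P)
    {W : Ω → β} (hW : Measurable[m] W) {F : β × 𝒳 → ℝ} (hF : Measurable F) {C : ℝ}
    (hC : ∀ᵐ ω ∂P, |F (W ω, X ω)| ≤ C) :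
    Integrable (fun ω => ∫ x, F (W ω, x) ∂G) P ∧
      ∫ ω, F (W ω, X ω) ∂P = ∫ ω, ∫ x, F (W ω, x) ∂G ∂P := by
  have hW' : Measurable W := hW.mono hm le_rfl
  have hindep : ProbabilityTheory.IndepFun W X P :=
    (ProbabilityTheory.IndepFun_iff_Indep W X P).mpr
      ((ProbabilityTheory.indep_of_indep_of_le_right hind hW.comap_le).symm)
  have hmap := (ProbabilityTheory.indepFun_iff_map_prod_eq_prod_map_map hW'.aemeasurable
    hX.aemeasurable).mp hindep
  have : IsProbabilityMeasure (P.map W) := Measure.isProbabilityMeasure_map hW'.aemeasurable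
  have : IsProbabilityMeasure G := hG ▸ Measure.isProbabilityMeasure_map hX.aemeasurable
  rw [hG] at hmap
  have hint : Integrable F ((P.map W).prod G) := by
    rw [← hmap, integrable_map_measure hF.aestronglyMeasurable (hW'.prodMk hX).aemeasurable]
    exact Integrable.of_bound (hF.comp (hW'.prodMk hX)).aestronglyMeasurable C hC
  have hmeas : StronglyMeasurable fun w => ∫ x, F (w, x) ∂G :=
    hF.stronglyMeasurable.integral_prod_right'
  constructor
  · exact (integrable_map_measure hmeas.aestronglyMeasurable hW'.aemeasurable).mp
      hint.integral_prod_left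
  · rw [← integral_map hW'.aemeasurable hmeas.aestronglyMeasurable, ← integral_prod _ hint, ← hmap,
      integral_map (hW'.prodMk hX).aemeasurable hF.aestronglyMeasurable]

end General

/-! ### Expectations of losses in one round. -/

section Run

variable {Ω 𝒳 : Type*} [MeasurableSpace 𝒳] {K d T : ℕ}
  {G : Measure 𝒳} {φ : Fin K → 𝒳 → Fin d → ℝ} {𝒵 Θ : Set (Fin d → ℝ)} {lam : ℝ}
  {e : 𝒳 → Fin K → ℝ} {X : ℕ → Ω → 𝒳} {A : ℕ → Ω → Fin K} {θ : ℕ → Ω → Fin d → ℝ}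
  {ε : ℕ → Ω → Fin K → ℝ} {t : ℕ}

lemma measurable_param : Measurable[natureInfo φ X A θ ε t] (θ t) :=
  (comap_measurable _).mono le_sup_right le_rfl

section

variable [IsProbabilityMeasure G]

lemma measurable_runEstimate_pred (he : IsExploration G φ 𝒵 lam e) (hd : 1 ≤ d)
    (hφ : ∀ a, Measurable (φ a)) (ht : 1 ≤ t) :
    Measurable[natureInfo φ X A θ ε t] (runEstimate G φ lam e X A θ ε (t - 1)) := by
  have h1 := measurable_runEstimate (G := G) (X := X) (A := A) (θ := θ) (ε := ε) he.pos_arms hd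
    he.lam_pos hφ he.measurable (t - 1)
  rw [Nat.sub_add_cancel ht] at h1
  exact h1.mono le_sup_left le_rfl

lemma measurable_playedProb (he : IsExploration G φ 𝒵 lam e) (hd : 1 ≤ d)
    (hφ : ∀ a, Measurable (φ a)) (ht : 1 ≤ t) (a : Fin K) :
    Measurable[natureInfo φ X A θ ε t ⊔ MeasurableSpace.comap (X t) inferInstance]
      (playedProb (1 / 2) G φ lam e X A θ ε t a) := by
  have h1 : Measurable[natureInfo φ X A θ ε t ⊔ MeasurableSpace.comap (X t) inferInstance]
      (runEstimate G φ lam e X A θ ε (t - 1)) :=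
    (measurable_runEstimate_pred he hd hφ ht).mono le_sup_left le_rfl
  have h2 : Measurable[natureInfo φ X A θ ε t ⊔ MeasurableSpace.comap (X t) inferInstance] (X t) :=
    (comap_measurable _).mono le_sup_right le_rfl
  let _ : MeasurableSpace Ω := natureInfo φ X A θ ε t ⊔ MeasurableSpace.comap (X t) inferInstance
  exact measurable_policy he.pos_arms hd he.lam_pos hφ he.measurable t a h1 h2

lemma playedProb_mem_simplex (he : IsExploration G φ 𝒵 lam e) (hd : 1 ≤ d) (ω : Ω) :
    (fun a => playedProb (1 / 2) G φ lam e X A θ ε t a ω) ∈ stdSimplex ℝ (Fin K) :=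
  policy_mem_simplex he.pos_arms hd he.lam_pos he.mem_simplex t _ _

end

variable [MeasurableSpace Ω] {P : Measure Ω}

lemma IsRun.measurable_loss (h : IsRun (1 / 2) P G φ Θ lam e T X A θ ε)
    (hφ : ∀ a, Measurable (φ a)) (ht : t ∈ Finset.Icc 1 T) {B : Ω → Fin K} (hB : Measurable B) :
    Measurable fun ω => loss φ θ ε t (B ω) (X t ω) ω := by
  have h1 : Measurable fun ω => φ (B ω) (X t ω) :=
    (measurable_features hφ).comp ((h.measurable_X t ht).prodMk hB)
  have h2 : Measurable fun ω => ε t ω (B ω) :=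
    (measurable_from_prod_countable_left (f := fun p : (Fin K → ℝ) × Fin K => p.1 p.2)
      fun a => measurable_pi_apply a).comp ((h.measurable_ε t ht).prodMk hB)
  refine Measurable.add (Finset.measurable_sum _ fun i _ => ?_) h2
  exact ((measurable_pi_apply i).comp h1).mul
    ((measurable_pi_apply i).comp (h.measurable_θ t ht))

lemma IsRun.natureInfo_le (h : IsRun (1 / 2) P G φ Θ lam e T X A θ ε)
    (hφ : ∀ a, Measurable (φ a)) (ht : t ∈ Finset.Icc 1 T) :
    natureInfo φ X A θ ε t ≤ ‹MeasurableSpace Ω› := by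
  refine sup_le (iSup₂_le fun s hs => ?_) (h.measurable_θ t ht).comap_le
  have hs' : s ∈ Finset.Icc 1 T := by
    rw [Finset.mem_Ico] at hs
    rw [Finset.mem_Icc] at ht ⊢
    omega
  exact ((h.measurable_X s hs').prodMk ((h.measurable_A s hs').prodMk
    (h.measurable_loss hφ hs' (h.measurable_A s hs')))).comap_le

lemma IsRun.ae_abs_dotProduct_le (h : IsRun (1 / 2) P G φ Θ lam e T X A θ ε)
    (hmem : ∀ a x, φ a x ∈ 𝒵) (hle : ∀ z ∈ 𝒵, ∀ ϑ ∈ Θ, |z ⬝ᵥ ϑ| ≤ 1)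
    (ht : t ∈ Finset.Icc 1 T) : ∀ᵐ ω ∂P, ∀ a x, |φ a x ⬝ᵥ θ t ω| ≤ 1 := by
  filter_upwards [h.θ_mem t ht] with ω hω a x
  exact hle _ (hmem a x) _ hω

lemma IsRun.ae_abs_noise_le (h : IsRun (1 / 2) P G φ Θ lam e T X A θ ε)
    (hmem : ∀ a x, φ a x ∈ 𝒵) (hle : ∀ z ∈ 𝒵, ∀ ϑ ∈ Θ, |z ⬝ᵥ ϑ| ≤ 1)
    (ht : t ∈ Finset.Icc 1 T) : ∀ᵐ ω ∂P, ∀ a, |ε t ω a| ≤ 2 := by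
  filter_upwards [h.ae_abs_dotProduct_le hmem hle ht, h.loss_le t ht] with ω h1 h2 a
  have h3 := abs_le.mp (h1 a (X t ω))
  have h4 := abs_le.mp (h2 a (X t ω))
  simp only [loss] at h4
  exact abs_le.mpr ⟨by linarith, by linarith⟩

variable [IsProbabilityMeasure P]

lemma IsRun.integrable_noise (h : IsRun (1 / 2) P G φ Θ lam e T X A θ ε)
    (hmem : ∀ a x, φ a x ∈ 𝒵) (hle : ∀ z ∈ 𝒵, ∀ ϑ ∈ Θ, |z ⬝ᵥ ϑ| ≤ 1)
    (ht : t ∈ Finset.Icc 1 T) (a : Fin K) : Integrable (fun ω => ε t ω a) P :=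
  Integrable.of_bound ((measurable_pi_apply a).comp (h.measurable_ε t ht)).aestronglyMeasurable 2
    ((h.ae_abs_noise_le hmem hle ht).mono fun _ hω => hω a)

/-- The expected loss of a comparator policy. -/
lemma IsRun.integral_loss_comparator (h : IsRun (1 / 2) P G φ Θ lam e T X A θ ε)
    (hφ : ∀ a, Measurable (φ a)) (hmem : ∀ a x, φ a x ∈ 𝒵)
    (hle : ∀ z ∈ 𝒵, ∀ ϑ ∈ Θ, |z ⬝ᵥ ϑ| ≤ 1)
    (ht : t ∈ Finset.Icc 1 T) {ρ : 𝒳 → Fin K} (hρ : Measurable ρ) :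
    Integrable (fun ω => ∫ x, φ (ρ x) x ⬝ᵥ θ t ω ∂G) P ∧
    ∫ ω, loss φ θ ε t (ρ (X t ω)) (X t ω) ω ∂P = ∫ ω, ∫ x, φ (ρ x) x ⬝ᵥ θ t ω ∂G ∂P := by
  have hm := h.natureInfo_le hφ ht
  have hXm := h.measurable_X t ht
  have hεm := h.measurable_ε t ht
  have hθm := h.measurable_θ t ht
  have hm1 : natureInfo φ X A θ ε t ⊔ MeasurableSpace.comap (X t) inferInstance ≤
      ‹MeasurableSpace Ω› := sup_le hm hXm.comap_le
  have hεae := h.ae_abs_noise_le hmem hle ht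
  have hφθ := h.ae_abs_dotProduct_le hmem hle ht
  have hFm : Measurable fun p : (Fin d → ℝ) × 𝒳 => φ (ρ p.2) p.2 ⬝ᵥ p.1 :=
    Finset.measurable_sum _ fun i _ => ((measurable_pi_apply i).comp
      ((measurable_features hφ).comp (measurable_snd.prodMk (hρ.comp measurable_snd)))).mul
        ((measurable_pi_apply i).comp measurable_fst)
  have hlin := integral_comp_context (C := 1) hm hXm (h.law_X t ht) (h.indep_X t ht)
    (W := θ t) (F := fun p => φ (ρ p.2) p.2 ⬝ᵥ p.1) measurable_param hFm
    (hφθ.mono fun ω hω => hω _ _)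
  refine ⟨hlin.1, ?_⟩
  rw [← hlin.2]
  have hρX : Measurable[natureInfo φ X A θ ε t ⊔ MeasurableSpace.comap (X t) inferInstance]
      fun ω => ρ (X t ω) := hρ.comp ((comap_measurable _).mono le_sup_right le_rfl)
  have hind : ∀ a, Measurable[natureInfo φ X A θ ε t ⊔ MeasurableSpace.comap (X t) inferInstance]
      (((fun ω => ρ (X t ω)) ⁻¹' {a}).indicator fun _ => (1 : ℝ)) := fun a =>
    measurable_const.indicator (hρX (measurableSet_singleton a))
  have hb : ∀ a, ∀ᵐ ω ∂P, |((fun ω => ρ (X t ω)) ⁻¹' {a}).indicator (fun _ => (1 : ℝ)) ω| ≤ 1 :=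
    fun a => Filter.Eventually.of_forall fun ω => by
      by_cases hω : ω ∈ (fun ω => ρ (X t ω)) ⁻¹' {a} <;> simp [Set.indicator, hω]
  -- The comparator's arm is known given `X t`, so splitting by its value leaves known factors times
  -- centred noise.
  have hnoise : ∫ ω, ε t ω (ρ (X t ω)) ∂P = 0 := by
    have h1 : ∀ ω, ε t ω (ρ (X t ω)) =
        ∑ a, ((fun ω => ρ (X t ω)) ⁻¹' {a}).indicator (fun _ => (1 : ℝ)) ω * ε t ω a := fun ω => by
      rw [Finset.sum_eq_single (ρ (X t ω))]
      · simp
      · intro b _ hb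
        rw [Set.indicator_of_notMem (by simpa using hb.symm), zero_mul]
      · simp
    simp only [h1]
    rw [integral_finsetSum]
    · exact Finset.sum_eq_zero fun a _ => integral_mul_eq_zero_of_condExp hm1 (hind a) (hb a)
        (h.integrable_noise hmem hle ht a) (h.noise t ht a)
    · exact fun a _ => (h.integrable_noise hmem hle ht a).bdd_mul
        ((hind a).mono hm1 le_rfl).aestronglyMeasurable (hb a)
  have hερ : Measurable fun ω => ε t ω (ρ (X t ω)) :=
    (measurable_from_prod_countable_left (f := fun p : (Fin K → ℝ) × Fin K => p.1 p.2)
      fun a => measurable_pi_apply a).comp (hεm.prodMk (hρ.comp hXm))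
  simp only [loss]
  rw [integral_add, hnoise, add_zero]
  · exact Integrable.of_bound (hFm.comp (hθm.prodMk hXm)).aestronglyMeasurable 1
      (hφθ.mono fun ω hω => hω _ _)
  · exact Integrable.of_bound hερ.aestronglyMeasurable 2 (hεae.mono fun ω hω => hω _)

variable [IsProbabilityMeasure G]

variable {β : Type*} [MeasurableSpace β] {W : Ω → β} {F : Fin K → β × 𝒳 → ℝ} {C : ℝ}

/-- The expectation of a function of the arm and the context of round `t`, given the past. -/
lemma IsRun.integral_arm_context (h : IsRun (1 / 2) P G φ Θ lam e T X A θ ε)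
    (he : IsExploration G φ 𝒵 lam e) (hd : 1 ≤ d) (hφ : ∀ a, Measurable (φ a))
    (ht : t ∈ Finset.Icc 1 T) (hW : Measurable[natureInfo φ X A θ ε t] W)
    (hF : ∀ a, Measurable (F a)) (hC : ∀ᵐ ω ∂P, ∀ a, |F a (W ω, X t ω)| ≤ C) :
    Integrable (fun ω => ∫ x, ∑ a, policy (1 / 2) φ lam e t
      (runEstimate G φ lam e X A θ ε (t - 1) ω) x a * F a (W ω, x) ∂G) P ∧
    ∫ ω, F (A t ω) (W ω, X t ω) ∂P = ∫ ω, ∫ x, ∑ a, policy (1 / 2) φ lam e t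
      (runEstimate G φ lam e X A θ ε (t - 1) ω) x a * F a (W ω, x) ∂G ∂P := by
  have hm := h.natureInfo_le hφ ht
  have ht1 : 1 ≤ t := (Finset.mem_Icc.mp ht).1
  have hXm := h.measurable_X t ht
  have hεm := h.measurable_ε t ht
  have hm2 : natureInfo φ X A θ ε t ⊔ MeasurableSpace.comap (X t) inferInstance ⊔
      MeasurableSpace.comap (ε t) inferInstance ≤ ‹MeasurableSpace Ω› :=
    sup_le (sup_le hm hXm.comap_le) hεm.comap_le
  have hW2 : Measurable[natureInfo φ X A θ ε t ⊔ MeasurableSpace.comap (X t) inferInstance ⊔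
      MeasurableSpace.comap (ε t) inferInstance] fun ω => (W ω, X t ω) :=
    (hW.mono (le_sup_left.trans le_sup_left) le_rfl).prodMk
      ((comap_measurable _).mono (le_sup_right.trans le_sup_left) le_rfl)
  -- The arm is averaged out first, given the context; then the context, which is independent of the
  -- past, is averaged out by Fubini.
  rw [integral_comp_arm hm2 (h.measurable_A t ht) (h.action t ht)
    (f := fun a ω => F a (W ω, X t ω)) (fun a => (hF a).comp hW2) hC]
  refine integral_comp_context (C := C) hm hXm (h.law_X t ht) (h.indep_X t ht)
    (W := fun ω => (runEstimate G φ lam e X A θ ε (t - 1) ω, W ω))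
    (F := fun p => ∑ a, policy (1 / 2) φ lam e t p.1.1 p.2 a * F a (p.1.2, p.2))
    ((measurable_runEstimate_pred he hd hφ ht1).prodMk hW) ?_ ?_
  · refine Finset.measurable_sum _ fun a _ => ?_
    refine Measurable.mul ?_ ?_
    · exact measurable_policy he.pos_arms hd he.lam_pos hφ he.measurable t a
        (measurable_fst.comp measurable_fst) measurable_snd
    · exact (hF a).comp ((measurable_snd.comp measurable_fst).prodMk measurable_snd)
  · filter_upwards [hC] with ω hω
    exact abs_sum_simplex_mul_le
      (policy_mem_simplex he.pos_arms hd he.lam_pos he.mem_simplex t _ _) hω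

/-- The noise does not contribute to the expectation of a weighted loss. -/
lemma IsRun.integral_mul_loss (h : IsRun (1 / 2) P G φ Θ lam e T X A θ ε)
    (he : IsExploration G φ 𝒵 lam e) (hd : 1 ≤ d) (hφ : ∀ a, Measurable (φ a))
    (hmem : ∀ a x, φ a x ∈ 𝒵) (hle : ∀ z ∈ 𝒵, ∀ ϑ ∈ Θ, |z ⬝ᵥ ϑ| ≤ 1)
    (ht : t ∈ Finset.Icc 1 T) (hW : Measurable[natureInfo φ X A θ ε t] W)
    (hF : ∀ a, Measurable (F a)) (hC : ∀ a p, |F a p| ≤ C) :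
    Integrable (fun ω => ∫ x, ∑ a, policy (1 / 2) φ lam e t
      (runEstimate G φ lam e X A θ ε (t - 1) ω) x a *
        (F a (W ω, x) * (φ a x ⬝ᵥ θ t ω)) ∂G) P ∧
    ∫ ω, F (A t ω) (W ω, X t ω) * loss φ θ ε t (A t ω) (X t ω) ω ∂P =
      ∫ ω, ∫ x, ∑ a, policy (1 / 2) φ lam e t
        (runEstimate G φ lam e X A θ ε (t - 1) ω) x a *
          (F a (W ω, x) * (φ a x ⬝ᵥ θ t ω)) ∂G ∂P := by
  have hm := h.natureInfo_le hφ ht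
  have ht1 : 1 ≤ t := (Finset.mem_Icc.mp ht).1
  have hXm := h.measurable_X t ht
  have hεm := h.measurable_ε t ht
  have hθm := h.measurable_θ t ht
  have hAm := h.measurable_A t ht
  have hK := he.pos_arms
  have hC0 : 0 ≤ C := by
    obtain ⟨ω⟩ := P.nonempty_of_neZero
    exact (abs_nonneg _).trans (hC ⟨0, hK⟩ (W ω, X t ω))
  have hm1 : natureInfo φ X A θ ε t ⊔ MeasurableSpace.comap (X t) inferInstance ≤
      ‹MeasurableSpace Ω› := sup_le hm hXm.comap_le
  have hm2 : natureInfo φ X A θ ε t ⊔ MeasurableSpace.comap (X t) inferInstance ⊔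
      MeasurableSpace.comap (ε t) inferInstance ≤ ‹MeasurableSpace Ω› :=
    sup_le hm1 hεm.comap_le
  have hW1 : Measurable[natureInfo φ X A θ ε t ⊔ MeasurableSpace.comap (X t) inferInstance]
      fun ω => (W ω, X t ω) :=
    (hW.mono le_sup_left le_rfl).prodMk ((comap_measurable _).mono le_sup_right le_rfl)
  have hW2 : Measurable[natureInfo φ X A θ ε t ⊔ MeasurableSpace.comap (X t) inferInstance ⊔
      MeasurableSpace.comap (ε t) inferInstance] fun ω => (W ω, X t ω) :=
    hW1.mono le_sup_left le_rfl
  have hε2 : Measurable[natureInfo φ X A θ ε t ⊔ MeasurableSpace.comap (X t) inferInstance ⊔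
      MeasurableSpace.comap (ε t) inferInstance] (ε t) :=
    (comap_measurable _).mono le_sup_right le_rfl
  have hεae := h.ae_abs_noise_le hmem hle ht
  have hφθ := h.ae_abs_dotProduct_le hmem hle ht
  have hlin := h.integral_arm_context (C := C) he hd hφ ht (W := fun ω => (W ω, θ t ω))
    (F := fun a p => F a (p.1.1, p.2) * (φ a p.2 ⬝ᵥ p.1.2)) (hW.prodMk measurable_param)
    (fun a => by
      refine ((hF a).comp ((measurable_fst.comp measurable_fst).prodMk measurable_snd)).mul ?_
      exact Finset.measurable_sum _ fun i _ =>
        ((measurable_pi_apply i).comp ((hφ a).comp measurable_snd)).mul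
          ((measurable_pi_apply i).comp (measurable_snd.comp measurable_fst)))
    (by
      filter_upwards [hφθ] with ω hω a
      rw [abs_mul]
      calc _ ≤ C * 1 := mul_le_mul (hC _ _) (hω _ _) (abs_nonneg _) hC0
        _ = C := mul_one C)
  refine ⟨hlin.1, ?_⟩
  rw [← hlin.2]
  -- The order of conditioning matters. Given the noise as well, the arm is replaced by its
  -- probabilities; these do not depend on the noise, which then has conditional mean zero.
  have hnoise : ∫ ω, F (A t ω) (W ω, X t ω) * ε t ω (A t ω) ∂P = 0 := by
    rw [integral_comp_arm hm2 hAm (h.action t ht) (C := C * 2)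
      (f := fun a ω => F a (W ω, X t ω) * ε t ω a)
      (fun a => ((hF a).comp hW2).mul ((measurable_pi_apply a).comp hε2))]
    · have hb : ∀ a, ∀ᵐ ω ∂P,
          |playedProb (1 / 2) G φ lam e X A θ ε t a ω * F a (W ω, X t ω)| ≤ 1 * C := fun a =>
        Filter.Eventually.of_forall fun ω => by
          have hp := playedProb_mem_simplex (X := X) (A := A) (θ := θ) (ε := ε) (t := t) he hd ω
          rw [abs_mul, abs_of_nonneg (hp.1 a)]
          exact mul_le_mul ((Finset.single_le_sum
            (f := fun a => playedProb (1 / 2) G φ lam e X A θ ε t a ω)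
            (fun b _ => hp.1 b) (Finset.mem_univ a)).trans_eq hp.2) (hC _ _) (abs_nonneg _)
            zero_le_one
      have hmeas : ∀ a, Measurable[natureInfo φ X A θ ε t ⊔
          MeasurableSpace.comap (X t) inferInstance] fun ω =>
          playedProb (1 / 2) G φ lam e X A θ ε t a ω * F a (W ω, X t ω) := fun a =>
        (measurable_playedProb he hd hφ ht1 a).mul ((hF a).comp hW1)
      simp only [← mul_assoc]
      rw [integral_finsetSum]
      · exact Finset.sum_eq_zero fun a _ => integral_mul_eq_zero_of_condExp hm1 (hmeas a) (hb a)
          (h.integrable_noise hmem hle ht a) (h.noise t ht a)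
      · exact fun a _ => (h.integrable_noise hmem hle ht a).bdd_mul
          ((hmeas a).mono hm1 le_rfl).aestronglyMeasurable (hb a)
    · filter_upwards [hεae] with ω hω a
      rw [abs_mul]
      exact mul_le_mul (hC _ _) (hω a) (abs_nonneg _) hC0
  have hFA : Measurable fun ω => F (A t ω) (W ω, X t ω) :=
    (measurable_from_prod_countable_left (f := fun p : (β × 𝒳) × Fin K => F p.2 p.1)
      fun a => hF a).comp (((hW.mono hm le_rfl).prodMk hXm).prodMk hAm)
  have hφA : Measurable fun ω => φ (A t ω) (X t ω) ⬝ᵥ θ t ω :=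
    Finset.measurable_sum _ fun i _ => ((measurable_pi_apply i).comp
      ((measurable_features hφ).comp (hXm.prodMk hAm))).mul ((measurable_pi_apply i).comp hθm)
  have hεA : Measurable fun ω => ε t ω (A t ω) :=
    (measurable_from_prod_countable_left (f := fun p : (Fin K → ℝ) × Fin K => p.1 p.2)
      fun a => measurable_pi_apply a).comp (hεm.prodMk hAm)
  simp only [loss, mul_add]
  rw [integral_add, hnoise, add_zero]
  · refine Integrable.of_bound (hFA.mul hφA).aestronglyMeasurable (C * 1) ?_
    filter_upwards [hφθ] with ω hω
    rw [Real.norm_eq_abs, abs_mul]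
    exact mul_le_mul (hC _ _) (hω _ _) (abs_nonneg _) hC0
  · refine Integrable.of_bound (hFA.mul hεA).aestronglyMeasurable (C * 2) ?_
    filter_upwards [hεae] with ω hω
    rw [Real.norm_eq_abs, abs_mul]
    exact mul_le_mul (hC _ _) (hω _) (abs_nonneg _) hC0

end Run

/-! ### The estimator for a fixed past: size, mean feature gap, unbiasedness. -/

section Estimator

variable {𝒳 : Type*} [MeasurableSpace 𝒳] {K d : ℕ} {G : Measure 𝒳} [IsProbabilityMeasure G]
  {φ : Fin K → 𝒳 → Fin d → ℝ} {𝒵 : Set (Fin d → ℝ)} {lam : ℝ} {e : 𝒳 → Fin K → ℝ}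

lemma IsExploration.measurable_policy_slice (he : IsExploration G φ 𝒵 lam e) (hd : 1 ≤ d)
    (hφ : ∀ a, Measurable (φ a)) (t : ℕ) (S : Fin d → ℝ) :
    Measurable (policy (1 / 2) φ lam e t S) :=
  measurable_pi_lambda _ fun a => measurable_policy he.pos_arms hd he.lam_pos hφ he.measurable t a
    measurable_const measurable_id

lemma IsExploration.measurable_weights_slice (he : IsExploration G φ 𝒵 lam e) (hd : 1 ≤ d)
    (hφ : ∀ a, Measurable (φ a)) (t : ℕ) (S : Fin d → ℝ) :
    Measurable (weights (1 / 2) φ lam t S) :=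
  measurable_pi_lambda _ fun a => measurable_weights he.pos_arms hd he.lam_pos hφ t a
    measurable_const measurable_id

lemma IsExploration.posDef_cov_policy (he : IsExploration G φ 𝒵 lam e) (hd : 1 ≤ d)
    (hφ : ∀ a, Measurable (φ a)) (hmem : ∀ a x, φ a x ∈ 𝒵) (t : ℕ) (S : Fin d → ℝ) :
    (cov G φ (policy (1 / 2) φ lam e t S)).PosDef := by
  obtain ⟨B, hB⟩ := he.exists_bound hmem
  exact posDef_cov_of_le hφ hB (he.measurable_policy_slice hd hφ t S)
    (policy_mem_simplex he.pos_arms hd he.lam_pos he.mem_simplex t S) he.measurable he.mem_simplex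
    (explorationRate_pos he.pos_arms hd he.lam_pos t)
    (explorationRate_mul_le_policy he.pos_arms hd he.lam_pos t S) he.posDef

lemma IsExploration.dotProduct_inv_mulVec_nonneg (he : IsExploration G φ 𝒵 lam e) (hd : 1 ≤ d)
    (hφ : ∀ a, Measurable (φ a)) (hmem : ∀ a x, φ a x ∈ 𝒵) (t : ℕ) (S z : Fin d → ℝ) :
    0 ≤ z ⬝ᵥ (cov G φ (policy (1 / 2) φ lam e t S))⁻¹.mulVec z := by
  simpa using (he.posDef_cov_policy hd hφ hmem t S).inv.posSemidef.dotProduct_mulVec_nonneg z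

/-- Exploration keeps the importance weights below `1 / (8 η_t)`. -/
lemma IsExploration.abs_feature_inv_feature_le (he : IsExploration G φ 𝒵 lam e) (hd : 1 ≤ d)
    (hφ : ∀ a, Measurable (φ a)) (hmem : ∀ a x, φ a x ∈ 𝒵) (t : ℕ) (S : Fin d → ℝ)
    (a b : Fin K) (x y : 𝒳) :
    |φ a x ⬝ᵥ (cov G φ (policy (1 / 2) φ lam e t S))⁻¹.mulVec (φ b y)| ≤
      1 / (8 * learningRate K d lam t) := by
  obtain ⟨B, hB⟩ := he.exists_bound hmem
  have hM := he.posDef_cov_policy hd hφ hmem t S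
  have hl := he.lam_pos
  have hη := learningRate_pos he.pos_arms hd hl t
  -- `Σ_t` dominates `γ_t Σ(e)`, so the form is at most `1 / (lam γ_t)`, and `γ_t = 8 η_t / lam`.
  have h : ∀ a x, φ a x ⬝ᵥ (cov G φ (policy (1 / 2) φ lam e t S))⁻¹.mulVec (φ a x) ≤
      1 / (8 * learningRate K d lam t) := fun a x => by
    refine (dotProduct_inv_mulVec_le hM he.posDef (explorationRate_pos he.pos_arms hd hl t)
      (mul_dotProduct_cov_mulVec_le hφ hB (he.measurable_policy_slice hd hφ t S)
        (policy_mem_simplex he.pos_arms hd hl he.mem_simplex t S) he.measurable he.mem_simplex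
        (explorationRate_mul_le_policy he.pos_arms hd hl t S))
      (he.quad_le _ (hmem a x))).trans_eq ?_
    rw [explorationRate]
    field_simp
  exact abs_dotProduct_inv_mulVec_le hM (h a x) (h b y)

/-- The mean feature difference between the weights of round `t` and the comparator `ρ`. -/
def gap (G : Measure 𝒳) (φ : Fin K → 𝒳 → Fin d → ℝ) (lam : ℝ) (t : ℕ) (ρ : 𝒳 → Fin K)
    (S : Fin d → ℝ) : Fin d → ℝ := fun i =>
  ∫ x, (∑ a, weights (1 / 2) φ lam t S x a * φ a x i - φ (ρ x) x i) ∂G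

variable {ρ : 𝒳 → Fin K}

lemma IsExploration.measurable_gap (he : IsExploration G φ 𝒵 lam e) (hd : 1 ≤ d)
    (hφ : ∀ a, Measurable (φ a)) (hρ : Measurable ρ) (t : ℕ) :
    Measurable (gap G φ lam t ρ) := by
  refine measurable_pi_lambda _ fun i => ?_
  have h : Measurable fun p : (Fin d → ℝ) × 𝒳 =>
      ∑ a, weights (1 / 2) φ lam t p.1 p.2 a * φ a p.2 i - φ (ρ p.2) p.2 i := by
    refine Measurable.sub (Finset.measurable_sum _ fun a _ => ?_) ?_
    · exact (measurable_weights he.pos_arms hd he.lam_pos hφ t a measurable_fst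
        measurable_snd).mul ((measurable_pi_apply i).comp ((hφ a).comp measurable_snd))
    · exact (measurable_pi_apply i).comp ((measurable_features hφ).comp
        (measurable_snd.prodMk (hρ.comp measurable_snd)))
  exact (h.stronglyMeasurable.integral_prod_right' (ν := G)).measurable

lemma IsExploration.integrable_weights_sub (he : IsExploration G φ 𝒵 lam e) (hd : 1 ≤ d)
    (hφ : ∀ a, Measurable (φ a)) (hρ : Measurable ρ) (t : ℕ) (S : Fin d → ℝ)
    {f : Fin K → 𝒳 → ℝ} (hfm : ∀ a, Measurable (f a)) {C : ℝ} (hf : ∀ a x, |f a x| ≤ C) :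
    Integrable (fun x => ∑ a, weights (1 / 2) φ lam t S x a * f a x - f (ρ x) x) G := by
  refine (integrable_sum_simplex_mul (he.measurable_weights_slice hd hφ t S)
    (weights_mem_simplex he.pos_arms hd he.lam_pos t S) hfm hf).sub ?_
  refine Integrable.of_bound (C := C) ?_ (Filter.Eventually.of_forall fun x => hf _ _)
  exact ((measurable_from_prod_countable_left (f := fun p : 𝒳 × Fin K => f p.2 p.1)
    fun a => hfm a).comp (measurable_id.prodMk hρ)).aestronglyMeasurable

lemma IsExploration.gap_dotProduct (he : IsExploration G φ 𝒵 lam e) (hd : 1 ≤ d)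
    (hφ : ∀ a, Measurable (φ a)) (hmem : ∀ a x, φ a x ∈ 𝒵) (hρ : Measurable ρ) (t : ℕ)
    (S v : Fin d → ℝ) :
    gap G φ lam t ρ S ⬝ᵥ v =
      ∫ x, (∑ a, weights (1 / 2) φ lam t S x a * (φ a x ⬝ᵥ v) - φ (ρ x) x ⬝ᵥ v) ∂G := by
  obtain ⟨B, hB⟩ := he.exists_bound hmem
  have h : ∀ x, ∑ a, weights (1 / 2) φ lam t S x a * (φ a x ⬝ᵥ v) - φ (ρ x) x ⬝ᵥ v =
      ∑ i, (∑ a, weights (1 / 2) φ lam t S x a * φ a x i - φ (ρ x) x i) * v i := fun x => by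
    simp only [dotProduct, Finset.mul_sum, sub_mul, Finset.sum_sub_distrib, Finset.sum_mul]
    rw [Finset.sum_comm]
    simp only [mul_assoc]
  simp only [h]
  rw [integral_finsetSum]
  · simp only [integral_mul_const]
    rfl
  · exact fun i _ => (he.integrable_weights_sub hd hφ hρ t S (f := fun a x => φ a x i)
      (fun a => (measurable_pi_apply i).comp (hφ a)) fun a x => hB a x i).mul_const _

lemma IsExploration.abs_gap_dotProduct_le (he : IsExploration G φ 𝒵 lam e) (hd : 1 ≤ d)
    (hφ : ∀ a, Measurable (φ a)) (hmem : ∀ a x, φ a x ∈ 𝒵) (hρ : Measurable ρ) (t : ℕ)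
    (S : Fin d → ℝ) {v : Fin d → ℝ} {C : ℝ} (hC : ∀ a x, |φ a x ⬝ᵥ v| ≤ C) :
    |gap G φ lam t ρ S ⬝ᵥ v| ≤ 2 * C := by
  rw [he.gap_dotProduct hd hφ hmem hρ]
  have h := norm_integral_le_of_norm_le_const (μ := G) (C := 2 * C)
    (f := fun x => ∑ a, weights (1 / 2) φ lam t S x a * (φ a x ⬝ᵥ v) - φ (ρ x) x ⬝ᵥ v)
    (Filter.Eventually.of_forall fun x => by
      refine (norm_sub_le _ _).trans ?_
      rw [two_mul]
      exact add_le_add (abs_sum_simplex_mul_le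
        (weights_mem_simplex he.pos_arms hd he.lam_pos t S x) fun a => hC a x) (hC _ _))
  simpa using h

/-- The estimator is unbiased: `Σ(p)⁻¹` undoes the averaging of `φ φᵀ`. -/
lemma integral_inv_mulVec_mul (hφ : ∀ a, Measurable (φ a)) {B : ℝ} (hB : ∀ a x i, |φ a x i| ≤ B)
    {p : 𝒳 → Fin K → ℝ} (hpm : Measurable p) (hp : ∀ x, p x ∈ stdSimplex ℝ (Fin K))
    (hpos : (cov G φ p).PosDef) (w v : Fin d → ℝ) :
    ∫ x, ∑ a, p x a * ((w ⬝ᵥ (cov G φ p)⁻¹.mulVec (φ a x)) * (φ a x ⬝ᵥ v)) ∂G = w ⬝ᵥ v := by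
  have hsymm : ∀ {N : Matrix (Fin d) (Fin d) ℝ}, N.IsHermitian → ∀ y z : Fin d → ℝ,
      y ⬝ᵥ N.mulVec z = z ⬝ᵥ N.mulVec y := fun {N} hN y z => by
    have h1 := hN.eq
    rw [Matrix.conjTranspose_eq_transpose_of_trivial] at h1
    rw [Matrix.dotProduct_mulVec, ← Matrix.mulVec_transpose, h1, dotProduct_comm]
  simp only [hsymm hpos.inv.isHermitian w]
  rw [← dotProduct_cov_mulVec hφ hB hpm hp, hsymm hpos.isHermitian, mulVec_inv_mulVec hpos,
    dotProduct_comm]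

end Estimator

/-! ### From the excess loss of a round to the estimated losses. -/

section Rounds

variable {Ω 𝒳 : Type*} [MeasurableSpace Ω] [MeasurableSpace 𝒳] {K d T : ℕ} {P : Measure Ω}
  {G : Measure 𝒳}
  {φ : Fin K → 𝒳 → Fin d → ℝ} {𝒵 Θ : Set (Fin d → ℝ)} {lam : ℝ} {e : 𝒳 → Fin K → ℝ}
  {X : ℕ → Ω → 𝒳} {A : ℕ → Ω → Fin K} {θ : ℕ → Ω → Fin d → ℝ} {ε : ℕ → Ω → Fin K → ℝ} {t : ℕ}
  {ρ : 𝒳 → Fin K}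

/-- The estimate of round `t` along a run. -/
def runTheta (G : Measure 𝒳) (φ : Fin K → 𝒳 → Fin d → ℝ) (lam : ℝ) (e : 𝒳 → Fin K → ℝ)
    (X : ℕ → Ω → 𝒳) (A : ℕ → Ω → Fin K) (θ : ℕ → Ω → Fin d → ℝ) (ε : ℕ → Ω → Fin K → ℝ)
    (t : ℕ) (ω : Ω) : Fin d → ℝ :=
  thetaHat (1 / 2) G φ lam e t (runEstimate G φ lam e X A θ ε (t - 1) ω) (X t ω) (A t ω)
    (loss φ θ ε t (A t ω) (X t ω) ω)

/-- The squared feature of the played arm in the norm of `Σ_t⁻¹`. -/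
def leverage (G : Measure 𝒳) (φ : Fin K → 𝒳 → Fin d → ℝ) (lam : ℝ) (e : 𝒳 → Fin K → ℝ)
    (X : ℕ → Ω → 𝒳) (A : ℕ → Ω → Fin K) (θ : ℕ → Ω → Fin d → ℝ) (ε : ℕ → Ω → Fin K → ℝ)
    (t : ℕ) (ω : Ω) : ℝ :=
  φ (A t ω) (X t ω) ⬝ᵥ
    (cov G φ (policy (1 / 2) φ lam e t (runEstimate G φ lam e X A θ ε (t - 1) ω)))⁻¹.mulVec
      (φ (A t ω) (X t ω))

section

variable [IsProbabilityMeasure P]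

lemma IsRun.integrable_loss (h : IsRun (1 / 2) P G φ Θ lam e T X A θ ε)
    (hφ : ∀ a, Measurable (φ a)) (ht : t ∈ Finset.Icc 1 T) {B : Ω → Fin K} (hB : Measurable B) :
    Integrable (fun ω => loss φ θ ε t (B ω) (X t ω) ω) P :=
  Integrable.of_bound (h.measurable_loss hφ ht hB).aestronglyMeasurable 1
    ((h.loss_le t ht).mono fun _ hω => hω _ _)

end

variable [IsProbabilityMeasure G]

lemma IsRun.measurable_runTheta (h : IsRun (1 / 2) P G φ Θ lam e T X A θ ε)
    (he : IsExploration G φ 𝒵 lam e) (hd : 1 ≤ d) (hφ : ∀ a, Measurable (φ a))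
    (ht : t ∈ Finset.Icc 1 T) : Measurable (runTheta G φ lam e X A θ ε t) := by
  have hS := (measurable_runEstimate_pred (G := G) (X := X) (A := A) (θ := θ) (ε := ε) he hd hφ
    (Finset.mem_Icc.mp ht).1).mono (h.natureInfo_le hφ ht) le_rfl
  exact (measurable_thetaHat he.pos_arms hd he.lam_pos hφ he.measurable t).comp
    (hS.prodMk ((h.measurable_X t ht).prodMk ((h.measurable_A t ht).prodMk
      (h.measurable_loss hφ ht (h.measurable_A t ht)))))

lemma IsRun.ae_abs_dotProduct_runTheta_le (h : IsRun (1 / 2) P G φ Θ lam e T X A θ ε)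
    (he : IsExploration G φ 𝒵 lam e) (hd : 1 ≤ d) (hφ : ∀ a, Measurable (φ a))
    (hmem : ∀ a x, φ a x ∈ 𝒵) (ht : t ∈ Finset.Icc 1 T) : ∀ᵐ ω ∂P, ∀ a x,
      |φ a x ⬝ᵥ runTheta G φ lam e X A θ ε t ω| ≤ 1 / (8 * learningRate K d lam t) := by
  filter_upwards [h.loss_le t ht] with ω hω a x
  rw [runTheta, thetaHat, dotProduct_smul, smul_eq_mul, abs_mul]
  calc _ ≤ 1 * (1 / (8 * learningRate K d lam t)) :=
        mul_le_mul (hω _ _) (he.abs_feature_inv_feature_le hd hφ hmem t _ a _ x _)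
          (abs_nonneg _) zero_le_one
    _ = _ := one_mul _

variable [IsProbabilityMeasure P]

/-- The gap is a function of the past estimates only. Averaging over noise, arm and context replaces
the estimate by `Σ_t⁻¹ Σ_t θ_t = θ_t`. -/
lemma IsRun.integral_gap_dotProduct (h : IsRun (1 / 2) P G φ Θ lam e T X A θ ε)
    (he : IsExploration G φ 𝒵 lam e) (hd : 1 ≤ d) (hφ : ∀ a, Measurable (φ a))
    (hmem : ∀ a x, φ a x ∈ 𝒵) (hle : ∀ z ∈ 𝒵, ∀ ϑ ∈ Θ, |z ⬝ᵥ ϑ| ≤ 1)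
    (ht : t ∈ Finset.Icc 1 T) (hρ : Measurable ρ) :
    Integrable (fun ω =>
      gap G φ lam t ρ (runEstimate G φ lam e X A θ ε (t - 1) ω) ⬝ᵥ θ t ω) P ∧
    ∫ ω, gap G φ lam t ρ (runEstimate G φ lam e X A θ ε (t - 1) ω) ⬝ᵥ
        runTheta G φ lam e X A θ ε t ω ∂P =
      ∫ ω, gap G φ lam t ρ (runEstimate G φ lam e X A θ ε (t - 1) ω) ⬝ᵥ θ t ω ∂P := by
  obtain ⟨B, hB⟩ := he.exists_bound hmem
  have hS := measurable_runEstimate_pred (G := G) (X := X) (A := A) (θ := θ) (ε := ε) he hd hφ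
    (Finset.mem_Icc.mp ht).1
  have key := h.integral_mul_loss he hd hφ hmem hle ht hS
    (C := 2 * (1 / (8 * learningRate K d lam t)))
    (F := fun a p => gap G φ lam t ρ p.1 ⬝ᵥ
      (cov G φ (policy (1 / 2) φ lam e t p.1))⁻¹.mulVec (φ a p.2))
    (fun a => by
      have h1 : Measurable fun p : (Fin d → ℝ) × 𝒳 => gap G φ lam t ρ p.1 :=
        (he.measurable_gap hd hφ hρ t).comp measurable_fst
      have h3 : Measurable fun p : (Fin d → ℝ) × 𝒳 => p.1 := measurable_fst
      have h2 := measurable_cov_policy_inv_mulVec (G := G) he.pos_arms hd he.lam_pos hφ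
        he.measurable t h3 ((hφ a).comp measurable_snd)
      exact Finset.measurable_sum _ fun i _ =>
        (measurable_pi_iff.mp h1 i).mul (measurable_pi_iff.mp h2 i))
    (fun a p => he.abs_gap_dotProduct_le hd hφ hmem hρ t p.1 fun b y =>
      he.abs_feature_inv_feature_le hd hφ hmem t p.1 b a y p.2)
  have hunb : ∀ S v : Fin d → ℝ, ∫ x, ∑ a, policy (1 / 2) φ lam e t S x a *
      ((gap G φ lam t ρ S ⬝ᵥ (cov G φ (policy (1 / 2) φ lam e t S))⁻¹.mulVec (φ a x)) *
        (φ a x ⬝ᵥ v)) ∂G = gap G φ lam t ρ S ⬝ᵥ v := fun S v =>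
    integral_inv_mulVec_mul hφ hB (he.measurable_policy_slice hd hφ t S)
      (policy_mem_simplex he.pos_arms hd he.lam_pos he.mem_simplex t S)
      (he.posDef_cov_policy hd hφ hmem t S) _ _
  simp only [hunb] at key
  refine ⟨key.1, ?_⟩
  rw [← key.2]
  refine integral_congr_ae (Filter.Eventually.of_forall fun ω => ?_)
  simp only [runTheta, thetaHat, dotProduct_smul, smul_eq_mul]
  rw [mul_comm]

lemma IsRun.integrable_gap_runTheta (h : IsRun (1 / 2) P G φ Θ lam e T X A θ ε)
    (he : IsExploration G φ 𝒵 lam e) (hd : 1 ≤ d) (hφ : ∀ a, Measurable (φ a))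
    (hmem : ∀ a x, φ a x ∈ 𝒵) (ht : t ∈ Finset.Icc 1 T) (hρ : Measurable ρ) :
    Integrable (fun ω => gap G φ lam t ρ (runEstimate G φ lam e X A θ ε (t - 1) ω) ⬝ᵥ
        runTheta G φ lam e X A θ ε t ω) P := by
  have hS := (measurable_runEstimate_pred (G := G) (X := X) (A := A) (θ := θ) (ε := ε) he hd hφ
    (Finset.mem_Icc.mp ht).1).mono (h.natureInfo_le hφ ht) le_rfl
  have h1 := (he.measurable_gap hd hφ hρ t).comp hS
  have h2 := h.measurable_runTheta he hd hφ ht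
  refine Integrable.of_bound (C := 2 * (1 / (8 * learningRate K d lam t))) ?_ ?_
  · exact (Finset.measurable_sum _ fun i _ =>
      (measurable_pi_iff.mp h1 i).mul (measurable_pi_iff.mp h2 i)).aestronglyMeasurable
  · filter_upwards [h.ae_abs_dotProduct_runTheta_le he hd hφ hmem ht] with ω hω
    exact he.abs_gap_dotProduct_le hd hφ hmem hρ t _ hω

/-- For each fixed past, the average over context and arm is the trace identity for `Σ_t`, so the
dimension replaces the number of arms in the variance. -/
lemma IsRun.integral_leverage (h : IsRun (1 / 2) P G φ Θ lam e T X A θ ε)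
    (he : IsExploration G φ 𝒵 lam e) (hd : 1 ≤ d) (hφ : ∀ a, Measurable (φ a))
    (hmem : ∀ a x, φ a x ∈ 𝒵) (ht : t ∈ Finset.Icc 1 T) :
    Integrable (leverage G φ lam e X A θ ε t) P ∧
      ∫ ω, leverage G φ lam e X A θ ε t ω ∂P = d := by
  obtain ⟨B, hB⟩ := he.exists_bound hmem
  have hS := measurable_runEstimate_pred (G := G) (X := X) (A := A) (θ := θ) (ε := ε) he hd hφ
    (Finset.mem_Icc.mp ht).1
  have hFm : ∀ a, Measurable fun p : (Fin d → ℝ) × 𝒳 => φ a p.2 ⬝ᵥ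
      (cov G φ (policy (1 / 2) φ lam e t p.1))⁻¹.mulVec (φ a p.2) := fun a => by
    have h1 : Measurable fun p : (Fin d → ℝ) × 𝒳 => φ a p.2 := (hφ a).comp measurable_snd
    have h3 : Measurable fun p : (Fin d → ℝ) × 𝒳 => p.1 := measurable_fst
    have h2 := measurable_cov_policy_inv_mulVec (G := G) he.pos_arms hd he.lam_pos hφ
      he.measurable t h3 h1
    exact Finset.measurable_sum _ fun i _ =>
      (measurable_pi_iff.mp h1 i).mul (measurable_pi_iff.mp h2 i)
  have hb := fun ω a x => he.abs_feature_inv_feature_le hd hφ hmem t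
    (runEstimate G φ lam e X A θ ε (t - 1) ω) a a x x
  have key := h.integral_arm_context he hd hφ ht hS (F := fun a p => φ a p.2 ⬝ᵥ
    (cov G φ (policy (1 / 2) φ lam e t p.1))⁻¹.mulVec (φ a p.2)) hFm
    (Filter.Eventually.of_forall fun ω a => hb ω a (X t ω))
  constructor
  · have h3 : Measurable fun p : ((Fin d → ℝ) × 𝒳) × Fin K => φ p.2 p.1.2 ⬝ᵥ
        (cov G φ (policy (1 / 2) φ lam e t p.1.1))⁻¹.mulVec (φ p.2 p.1.2) :=
      measurable_from_prod_countable_left fun a => hFm a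
    have h4 := h3.comp (((hS.mono (h.natureInfo_le hφ ht) le_rfl).prodMk
      (h.measurable_X t ht)).prodMk (h.measurable_A t ht))
    exact Integrable.of_bound h4.aestronglyMeasurable _
      (Filter.Eventually.of_forall fun ω => hb ω (A t ω) (X t ω))
  · have h5 : ∀ S : Fin d → ℝ, ∫ x, ∑ a, policy (1 / 2) φ lam e t S x a * (φ a x ⬝ᵥ
        (cov G φ (policy (1 / 2) φ lam e t S))⁻¹.mulVec (φ a x)) ∂G = d := fun S =>
      integral_dotProduct_cov_inv_mulVec hφ hB (he.measurable_policy_slice hd hφ t S)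
        (policy_mem_simplex he.pos_arms hd he.lam_pos he.mem_simplex t S)
        (he.posDef_cov_policy hd hφ hmem t S)
    simp only [h5] at key
    simpa [leverage] using key.2

/-- The excess loss of a round is that of the weights up to the cost of exploration. -/
lemma IsRun.integral_loss_sub_le (h : IsRun (1 / 2) P G φ Θ lam e T X A θ ε)
    (he : IsExploration G φ 𝒵 lam e) (hd : 1 ≤ d) (hφ : ∀ a, Measurable (φ a))
    (hmem : ∀ a x, φ a x ∈ 𝒵) (hle : ∀ z ∈ 𝒵, ∀ ϑ ∈ Θ, |z ⬝ᵥ ϑ| ≤ 1)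
    (ht : t ∈ Finset.Icc 1 T) (hρ : Measurable ρ) :
    ∫ ω, (loss φ θ ε t (A t ω) (X t ω) ω - loss φ θ ε t (ρ (X t ω)) (X t ω) ω) ∂P ≤
      2 * explorationRate K d lam t +
        ∫ ω, gap G φ lam t ρ (runEstimate G φ lam e X A θ ε (t - 1) ω) ⬝ᵥ
          runTheta G φ lam e X A θ ε t ω ∂P := by
  obtain ⟨hgi, hge⟩ := h.integral_gap_dotProduct he hd hφ hmem hle ht hρ
  have hS := measurable_runEstimate_pred (G := G) (X := X) (A := A) (θ := θ) (ε := ε) he hd hφ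
    (Finset.mem_Icc.mp ht).1
  have h1 := h.integral_mul_loss he hd hφ hmem hle ht hS (C := 1) (F := fun _ _ => 1)
    (fun _ => measurable_const) (fun _ _ => by simp)
  simp only [one_mul] at h1
  have h2 := h.integral_loss_comparator hφ hmem hle ht hρ
  rw [integral_sub (h.integrable_loss hφ ht (h.measurable_A t ht))
    (h.integrable_loss (B := fun ω => ρ (X t ω)) hφ ht (hρ.comp (h.measurable_X t ht))),
    h1.2, h2.2, hge,
    ← integral_sub h1.1 h2.1]
  have h3 : ∫ ω, (2 * explorationRate K d lam t +
      gap G φ lam t ρ (runEstimate G φ lam e X A θ ε (t - 1) ω) ⬝ᵥ θ t ω) ∂P =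
      2 * explorationRate K d lam t +
      ∫ ω, gap G φ lam t ρ (runEstimate G φ lam e X A θ ε (t - 1) ω) ⬝ᵥ θ t ω ∂P := by
    rw [integral_add (integrable_const _) hgi]
    simp
  rw [← h3]
  refine integral_mono_ae (h1.1.sub h2.1) ((integrable_const _).add hgi) ?_
  filter_upwards [h.ae_abs_dotProduct_le hmem hle ht] with ω hω
  have hfm : ∀ a, Measurable fun x => φ a x ⬝ᵥ θ t ω := fun a =>
    measurable_dotProduct_const (hφ a) _
  have hγ := explorationRate_pos he.pos_arms hd he.lam_pos t
  rw [he.gap_dotProduct hd hφ hmem hρ, ← integral_sub]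
  · have h4 : ∀ c : ℝ, ∀ f : 𝒳 → ℝ, Integrable f G → c + ∫ x, f x ∂G = ∫ x, (c + f x) ∂G :=
      fun c f hf => by
        rw [integral_add (integrable_const _) hf]
        simp
    have h5 := he.integrable_weights_sub hd hφ hρ t (runEstimate G φ lam e X A θ ε (t - 1) ω)
      hfm hω
    rw [h4 _ _ h5]
    refine integral_mono ?_ ((integrable_const _).add h5) fun x => ?_
    · exact (integrable_sum_simplex_mul (he.measurable_policy_slice hd hφ t _)
        (policy_mem_simplex he.pos_arms hd he.lam_pos he.mem_simplex t _) hfm hω).sub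
        (Integrable.of_bound (measurable_dotProduct_const ((measurable_features hφ).comp
          (measurable_id.prodMk hρ)) (θ t ω)).aestronglyMeasurable 1
          (Filter.Eventually.of_forall fun x => hω _ _))
    · have h6 := abs_le.mp (abs_sum_simplex_mul_le (he.mem_simplex x) fun a => hω a x)
      have h7 := abs_le.mp (abs_sum_simplex_mul_le (weights_mem_simplex (φ := φ) he.pos_arms hd
        he.lam_pos t (runEstimate G φ lam e X A θ ε (t - 1) ω) x) fun a => hω a x)
      -- The policy differs from the weights by `γ_t (e - q)`, and both averages of `⟨φ, θ_t⟩` lie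
      -- in `[-1, 1]`.
      simp only [policy_apply, add_mul, Finset.sum_add_distrib, mul_assoc, ← Finset.mul_sum]
      nlinarith
  · exact integrable_sum_simplex_mul (he.measurable_policy_slice hd hφ t _)
      (policy_mem_simplex he.pos_arms hd he.lam_pos he.mem_simplex t _) hfm hω
  · exact Integrable.of_bound (measurable_dotProduct_const ((measurable_features hφ).comp
      (measurable_id.prodMk hρ)) (θ t ω)).aestronglyMeasurable 1
      (Filter.Eventually.of_forall fun x => hω _ _)

end Rounds

/-! ### The FTRL bound along a trajectory, integrated over a fresh context. -/

section Pathwise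

variable {Ω 𝒳 : Type*} [MeasurableSpace 𝒳] {K d T : ℕ}
  {G : Measure 𝒳}
  {φ : Fin K → 𝒳 → Fin d → ℝ} {𝒵 : Set (Fin d → ℝ)} {lam : ℝ} {e : 𝒳 → Fin K → ℝ}
  {X : ℕ → Ω → 𝒳} {A : ℕ → Ω → Fin K} {θ : ℕ → Ω → Fin d → ℝ} {ε : ℕ → Ω → Fin K → ℝ}
  {ρ : 𝒳 → Fin K}

lemma runEstimate_dotProduct (t : ℕ) (ω : Ω) (x : 𝒳) :
    (fun a => runEstimate G φ lam e X A θ ε t ω ⬝ᵥ φ a x) = ∑ s ∈ Finset.range t,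
      fun a => φ a x ⬝ᵥ runTheta G φ lam e X A θ ε (s + 1) ω := by
  induction t with
  | zero =>
    funext a
    simp [runEstimate, cumEstimate]
  | succ t ih =>
    rw [Finset.sum_range_succ, ← ih]
    funext a
    rw [Pi.add_apply, dotProduct_comm (φ a x), ← add_dotProduct]
    rfl

variable [IsProbabilityMeasure G]

/-- The second moment of the estimated losses under the weights is at most twice the leverage. -/
lemma IsExploration.integral_weights_mul_sq_le (he : IsExploration G φ 𝒵 lam e) (hd : 1 ≤ d)
    (hφ : ∀ a, Measurable (φ a)) (hmem : ∀ a x, φ a x ∈ 𝒵) (t : ℕ) {ω : Ω}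
    (hω : ∀ a x, |loss φ θ ε t a x ω| ≤ 1) :
    ∫ x, ∑ a, weights (1 / 2) φ lam t (runEstimate G φ lam e X A θ ε (t - 1) ω) x a *
      (φ a x ⬝ᵥ runTheta G φ lam e X A θ ε t ω) ^ 2 ∂G ≤
      2 * leverage G φ lam e X A θ ε t ω := by
  obtain ⟨B, hB⟩ := he.exists_bound hmem
  set S := runEstimate G φ lam e X A θ ε (t - 1) ω with hS
  set u := runTheta G φ lam e X A θ ε t ω with hu
  have hwm := he.measurable_weights_slice hd hφ t S
  have hw := weights_mem_simplex (φ := φ) he.pos_arms hd he.lam_pos t S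
  have h1 := mul_dotProduct_cov_mulVec_le (G := G) hφ hB (he.measurable_policy_slice hd hφ t S)
    (policy_mem_simplex he.pos_arms hd he.lam_pos he.mem_simplex t S) hwm hw
    (half_mul_weights_le_policy he.pos_arms hd he.lam_pos he.mem_simplex t S) u
  rw [dotProduct_cov_mulVec hφ hB hwm hw] at h1
  simp only [← sq] at h1
  -- As `u = ℓ Σ_t⁻¹ φ`, one factor `Σ_t` cancels one inverse.
  have h2 : u ⬝ᵥ (cov G φ (policy (1 / 2) φ lam e t S)).mulVec u =
      loss φ θ ε t (A t ω) (X t ω) ω ^ 2 * leverage G φ lam e X A θ ε t ω := by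
    have h3 : (cov G φ (policy (1 / 2) φ lam e t S)).mulVec u =
        loss φ θ ε t (A t ω) (X t ω) ω • φ (A t ω) (X t ω) := by
      rw [hu, runTheta, thetaHat, ← hS, Matrix.mulVec_smul,
        mulVec_inv_mulVec (he.posDef_cov_policy hd hφ hmem t S)]
    rw [h3, hu, runTheta, thetaHat, ← hS, leverage, ← hS, smul_dotProduct, dotProduct_smul,
      dotProduct_comm, smul_eq_mul, smul_eq_mul, sq, mul_assoc]
  have h4 : 0 ≤ leverage G φ lam e X A θ ε t ω :=
    he.dotProduct_inv_mulVec_nonneg hd hφ hmem t _ _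
  have h5 : loss φ θ ε t (A t ω) (X t ω) ω ^ 2 ≤ 1 :=
    (sq_le_one_iff_abs_le_one _).mpr (hω _ _)
  rw [h2] at h1
  nlinarith

/-- The regret of the weights against the estimated losses, averaged over the contexts. -/
lemma IsExploration.sum_gap_dotProduct_le (he : IsExploration G φ 𝒵 lam e) (hd : 1 ≤ d)
    (hφ : ∀ a, Measurable (φ a)) (hmem : ∀ a x, φ a x ∈ 𝒵) (hρ : Measurable ρ) {ω : Ω}
    (hω : ∀ t ∈ Finset.Icc 1 T, ∀ a x, |loss φ θ ε t a x ω| ≤ 1) :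
    ∑ t ∈ Finset.range T, gap G φ lam (t + 1) ρ (runEstimate G φ lam e X A θ ε t ω) ⬝ᵥ
        runTheta G φ lam e X A θ ε (t + 1) ω ≤
      2 * √(K : ℝ) / learningRate K d lam T + ∑ t ∈ Finset.range T,
        4 * learningRate K d lam t * leverage G φ lam e X A θ ε (t + 1) ω := by
  obtain ⟨B, hB⟩ := he.exists_bound hmem
  have hK := he.pos_arms
  have hl := he.lam_pos
  have hηpos := learningRate_pos hK hd hl
  let u : ℕ → Fin d → ℝ := fun t => runTheta G φ lam e X A θ ε (t + 1) ω
  let S : ℕ → Fin d → ℝ := fun t => runEstimate G φ lam e X A θ ε t ω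
  let w : ℕ → 𝒳 → Fin K → ℝ := fun t x => weights (1 / 2) φ lam (t + 1) (S t) x
  have hω' : ∀ t < T, ∀ a x, |loss φ θ ε (t + 1) a x ω| ≤ 1 := fun t ht =>
    hω _ (Finset.mem_Icc.mpr ⟨by omega, by omega⟩)
  -- The stability condition: `η_t ≤ 2 η_{t+1}` and estimated losses of size at most `1 / (8
  -- η_{t+1})` give even `1 / 4`.
  have hu : ∀ t < T, ∀ a x, learningRate K d lam t * |φ a x ⬝ᵥ u t| ≤ 1 / 2 := by
    intro t ht a x
    have h1 : |φ a x ⬝ᵥ u t| ≤ 1 / (8 * learningRate K d lam (t + 1)) := by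
      simp only [u]
      rw [runTheta, thetaHat, dotProduct_smul, smul_eq_mul, abs_mul]
      calc _ ≤ 1 * (1 / (8 * learningRate K d lam (t + 1))) :=
            mul_le_mul (hω' t ht _ _)
              (he.abs_feature_inv_feature_le hd hφ hmem (t + 1) _ a _ x _)
              (abs_nonneg _) zero_le_one
        _ = _ := one_mul _
    have h2 := learningRate_pred_le hK hd hl (he.lam_mul_dim_le hφ hmem) t
    have h3 := hηpos (t + 1)
    calc learningRate K d lam t * |φ a x ⬝ᵥ u t|
        ≤ 2 * learningRate K d lam (t + 1) * (1 / (8 * learningRate K d lam (t + 1))) :=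
          mul_le_mul h2 h1 (abs_nonneg _) (by positivity)
      _ ≤ 1 / 2 := by
          rw [mul_one_div, div_le_iff₀ (by positivity)]
          linarith
  -- Here `x` is unrelated to the observed contexts: the trajectory is frozen and each context has
  -- its own FTRL problem, with `ρ x` as its comparator arm.
  have hreg : ∀ x, ∑ t ∈ Finset.range T, (∑ a, w t x a * (φ a x ⬝ᵥ u t) - φ (ρ x) x ⬝ᵥ u t) ≤
      2 * √(K : ℝ) / learningRate K d lam T + ∑ t ∈ Finset.range T,
        2 * learningRate K d lam t * ∑ a, w t x a * (φ a x ⬝ᵥ u t) ^ 2 := fun x => by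
    have h1 := sum_ftrl_le hK (learningRate K d lam) hηpos (antitone_learningRate hd)
      (fun t a => φ a x ⬝ᵥ u t) T (fun t ht a => hu t ht a x) (ρ x)
    have h2 : ∀ t, ftrl (1 / 2) (learningRate K d lam t)
        (∑ s ∈ Finset.range t, fun a => φ a x ⬝ᵥ u s) = w t x := fun t => by
      rw [← runEstimate_dotProduct]
      rfl
    simp only [h2] at h1
    simp only [dotProduct_comm _ (w _ x)] at h1
    exact h1
  have hdot : ∀ t, Measurable (w t) := fun t => he.measurable_weights_slice hd hφ _ _
  have hws : ∀ t x, w t x ∈ stdSimplex ℝ (Fin K) := fun t x =>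
    weights_mem_simplex hK hd hl _ _ x
  have hbd : ∀ t a x, |φ a x ⬝ᵥ u t| ≤ B * ∑ i, |u t i| := fun t a x =>
    abs_dotProduct_le_sum (hB a x)
  have hi1 : ∀ t, Integrable (fun x => ∑ a, w t x a * (φ a x ⬝ᵥ u t) - φ (ρ x) x ⬝ᵥ u t) G :=
    fun t => he.integrable_weights_sub hd hφ hρ (t + 1) (S t)
      (f := fun a x => φ a x ⬝ᵥ u t) (fun a => measurable_dotProduct_const (hφ a) _) (hbd t)
  have hi2 : ∀ t, Integrable (fun x => ∑ a, w t x a * (φ a x ⬝ᵥ u t) ^ 2) G := fun t => by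
    simpa only [sq] using integrable_quad (G := G) hφ hB (hdot t) (hws t) (u t) (u t)
  have hi3 : Integrable (fun x => ∑ t ∈ Finset.range T,
      2 * learningRate K d lam t * ∑ a, w t x a * (φ a x ⬝ᵥ u t) ^ 2) G :=
    integrable_finsetSum _ fun t _ => (hi2 t).const_mul _
  have hmono := integral_mono (integrable_finsetSum _ fun t _ => hi1 t)
    ((integrable_const (2 * √(K : ℝ) / learningRate K d lam T)).add hi3) hreg
  have hconst : ∫ x, (2 * √(K : ℝ) / learningRate K d lam T + ∑ t ∈ Finset.range T,
      2 * learningRate K d lam t * ∑ a, w t x a * (φ a x ⬝ᵥ u t) ^ 2) ∂G =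
      2 * √(K : ℝ) / learningRate K d lam T + ∑ t ∈ Finset.range T,
        2 * learningRate K d lam t * ∫ x, ∑ a, w t x a * (φ a x ⬝ᵥ u t) ^ 2 ∂G := by
    rw [integral_add (integrable_const _) hi3,
      integral_finsetSum _ fun t _ => (hi2 t).const_mul _]
    simp only [integral_const_mul]
    simp
  have hgap : ∀ t, gap G φ lam (t + 1) ρ (S t) ⬝ᵥ u t =
      ∫ x, (∑ a, w t x a * (φ a x ⬝ᵥ u t) - φ (ρ x) x ⬝ᵥ u t) ∂G := fun t =>
    he.gap_dotProduct hd hφ hmem hρ (t + 1) (S t) (u t)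
  calc ∑ t ∈ Finset.range T, gap G φ lam (t + 1) ρ (S t) ⬝ᵥ u t
      = ∫ x, ∑ t ∈ Finset.range T, (∑ a, w t x a * (φ a x ⬝ᵥ u t) - φ (ρ x) x ⬝ᵥ u t) ∂G := by
        rw [integral_finsetSum _ fun t _ => hi1 t]
        exact Finset.sum_congr rfl fun t _ => hgap t
    _ ≤ 2 * √(K : ℝ) / learningRate K d lam T + ∑ t ∈ Finset.range T,
        2 * learningRate K d lam t * ∫ x, ∑ a, w t x a * (φ a x ⬝ᵥ u t) ^ 2 ∂G := by
        rw [← hconst]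
        exact hmono
    _ ≤ _ := by
        refine add_le_add_right (Finset.sum_le_sum fun t ht => ?_) _
        have h1 := he.integral_weights_mul_sq_le (X := X) (A := A) hd hφ hmem (t + 1)
          (hω' t (Finset.mem_range.mp ht))
        have h2 := hηpos t
        calc _ ≤ 2 * learningRate K d lam t * (2 * leverage G φ lam e X A θ ε (t + 1) ω) :=
              mul_le_mul_of_nonneg_left h1 (by positivity)
          _ = _ := by ring

end Pathwise

/-! ### Summing over the rounds and inserting the rates. -/

section Regret

variable {Ω 𝒳 : Type*} [MeasurableSpace Ω] [MeasurableSpace 𝒳] {K d T : ℕ} {P : Measure Ω}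
  [IsProbabilityMeasure P] {G : Measure 𝒳} [IsProbabilityMeasure G]
  {φ : Fin K → 𝒳 → Fin d → ℝ} {𝒵 Θ : Set (Fin d → ℝ)} {lam : ℝ} {e : 𝒳 → Fin K → ℝ}
  {X : ℕ → Ω → 𝒳} {A : ℕ → Ω → Fin K} {θ : ℕ → Ω → Fin d → ℝ} {ε : ℕ → Ω → Fin K → ℝ}
  {ρ : 𝒳 → Fin K}

/-- The regret in terms of the learning rates. -/
lemma IsRun.regretAgainst_le (h : IsRun (1 / 2) P G φ Θ lam e T X A θ ε)
    (he : IsExploration G φ 𝒵 lam e) (hd : 1 ≤ d) (hφ : ∀ a, Measurable (φ a))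
    (hmem : ∀ a x, φ a x ∈ 𝒵) (hle : ∀ z ∈ 𝒵, ∀ ϑ ∈ Θ, |z ⬝ᵥ ϑ| ≤ 1) (hρ : Measurable ρ) :
    regretAgainst P φ T X A θ ε ρ ≤ 2 * √(K : ℝ) / learningRate K d lam T +
      ∑ t ∈ Finset.range T, (4 * d * learningRate K d lam t +
        2 * explorationRate K d lam (t + 1)) := by
  have hT : ∀ t ∈ Finset.range T, t + 1 ∈ Finset.Icc 1 T := fun t ht => by
    rw [Finset.mem_range] at ht
    exact Finset.mem_Icc.mpr ⟨by omega, by omega⟩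
  have hgi : ∀ t ∈ Finset.range T, Integrable (fun ω => gap G φ lam (t + 1) ρ
      (runEstimate G φ lam e X A θ ε t ω) ⬝ᵥ runTheta G φ lam e X A θ ε (t + 1) ω) P :=
    fun t ht => h.integrable_gap_runTheta he hd hφ hmem (hT t ht) hρ
  have hlev := fun t ht => h.integral_leverage he hd hφ hmem (hT t ht)
  have hround := Finset.sum_le_sum fun t ht =>
    h.integral_loss_sub_le he hd hφ hmem hle (hT t ht) hρ
  have hleft : regretAgainst P φ T X A θ ε ρ = ∑ t ∈ Finset.range T,
      ∫ ω, (loss φ θ ε (t + 1) (A (t + 1) ω) (X (t + 1) ω) ω -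
        loss φ θ ε (t + 1) (ρ (X (t + 1) ω)) (X (t + 1) ω) ω) ∂P := by
    have hi : ∀ t ∈ Finset.Icc 1 T, Integrable (fun ω => loss φ θ ε t (A t ω) (X t ω) ω -
        loss φ θ ε t (ρ (X t ω)) (X t ω) ω) P := fun t ht =>
      (h.integrable_loss hφ ht (h.measurable_A t ht)).sub
        (h.integrable_loss hφ ht (hρ.comp (h.measurable_X t ht)))
    rw [regretAgainst, integral_finsetSum _ hi, ← Finset.Ico_add_one_right_eq_Icc,
      Finset.sum_Ico_eq_sum_range]
    simp only [Nat.add_sub_cancel, add_comm 1]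
  have hpath : ∑ t ∈ Finset.range T, ∫ ω, gap G φ lam (t + 1) ρ
      (runEstimate G φ lam e X A θ ε t ω) ⬝ᵥ runTheta G φ lam e X A θ ε (t + 1) ω ∂P ≤
      2 * √(K : ℝ) / learningRate K d lam T +
        ∑ t ∈ Finset.range T, 4 * learningRate K d lam t * d := by
    rw [← integral_finsetSum _ hgi]
    have hi : Integrable (fun ω => ∑ t ∈ Finset.range T,
        4 * learningRate K d lam t * leverage G φ lam e X A θ ε (t + 1) ω) P :=
      integrable_finsetSum _ fun t ht => (hlev t ht).1.const_mul _
    have hloss : ∀ᵐ ω ∂P, ∀ t ∈ Finset.Icc 1 T, ∀ a x, |loss φ θ ε t a x ω| ≤ 1 :=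
      (Finset.eventually_all _).mpr h.loss_le
    have hmono := integral_mono_ae (integrable_finsetSum _ hgi)
      ((integrable_const (2 * √(K : ℝ) / learningRate K d lam T)).add hi)
      (hloss.mono fun ω hω => he.sum_gap_dotProduct_le hd hφ hmem hρ hω)
    refine hmono.trans_eq ?_
    simp only [Pi.add_apply]
    rw [integral_add (integrable_const _) hi,
      integral_finsetSum _ fun t ht => (hlev t ht).1.const_mul _]
    simp only [integral_const_mul]
    rw [Finset.sum_congr rfl fun t ht => by rw [(hlev t ht).2]]
    simp
  rw [hleft]
  refine hround.trans ?_
  simp only [Finset.sum_add_distrib, Nat.add_sub_cancel]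
  have e1 : ∑ t ∈ Finset.range T, 4 * learningRate K d lam t * (d : ℝ) =
      ∑ t ∈ Finset.range T, 4 * (d : ℝ) * learningRate K d lam t :=
    Finset.sum_congr rfl fun t _ => by ring
  linarith

lemma sum_range_one_div_sqrt_le (T : ℕ) :
    ∑ t ∈ Finset.range T, 1 / √((t + 1 : ℕ) : ℝ) ≤ 2 * √(T : ℝ) := by
  induction T with
  | zero => simp
  | succ T ih =>
    rw [Finset.sum_range_succ]
    have h1 : 0 < √((T + 1 : ℕ) : ℝ) := by positivity
    have h2 : √((T + 1 : ℕ) : ℝ) ^ 2 = T + 1 := by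
      rw [Real.sq_sqrt (by positivity)]
      push_cast
      ring
    have h3 : √(T : ℝ) ^ 2 = T := Real.sq_sqrt (by positivity)
    have h4 : 1 / √((T + 1 : ℕ) : ℝ) ≤ 2 * √((T + 1 : ℕ) : ℝ) - 2 * √(T : ℝ) := by
      rw [div_le_iff₀ h1]
      nlinarith [sq_nonneg (√((T + 1 : ℕ) : ℝ) - √(T : ℝ))]
    linarith

lemma sum_learningRate_le (hd : 1 ≤ d) :
    ∑ t ∈ Finset.range T, learningRate K d lam (t + 1) ≤
      2 * ((K : ℝ) ^ (1 / 4 : ℝ) * √(T : ℝ) / √(d : ℝ)) := by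
  have hd' : (0 : ℝ) < d := by exact_mod_cast hd
  have h1 : ∀ t ∈ Finset.range T, learningRate K d lam (t + 1) ≤
      (K : ℝ) ^ (1 / 4 : ℝ) / √(d : ℝ) * (1 / √((t + 1 : ℕ) : ℝ)) := fun t _ => by
    rw [learningRate, if_neg (by omega), Real.sqrt_mul hd'.le, div_mul_div_comm, mul_one]
    exact min_le_left _ _
  refine (Finset.sum_le_sum h1).trans ?_
  rw [← Finset.mul_sum]
  calc _ ≤ (K : ℝ) ^ (1 / 4 : ℝ) / √(d : ℝ) * (2 * √(T : ℝ)) :=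
        mul_le_mul_of_nonneg_left (sum_range_one_div_sqrt_le T) (by positivity)
    _ = _ := by ring

/-- The reciprocal of a minimum is at most the sum of the reciprocals; at `t = 0` the first summand
vanishes. -/
lemma one_div_learningRate_le (hK : 0 < K) (hd : 1 ≤ d) (hl : 0 < lam) (t : ℕ) :
    1 / learningRate K d lam t ≤ √(d : ℝ) * √(t : ℝ) / (K : ℝ) ^ (1 / 4 : ℝ) + 16 / lam := by
  have hK' : (0 : ℝ) < K := by exact_mod_cast hK
  have hd' : (0 : ℝ) < d := by exact_mod_cast hd
  have hk : 0 < (K : ℝ) ^ (1 / 4 : ℝ) := by positivity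
  unfold learningRate
  split_ifs with h
  · subst h
    simp
  · have ht : (0 : ℝ) < t := by exact_mod_cast Nat.pos_of_ne_zero h
    rcases min_choice ((K : ℝ) ^ (1 / 4 : ℝ) / √((d : ℝ) * t)) (lam / 16) with h | h
    · rw [h, one_div_div, Real.sqrt_mul hd'.le]
      have : 0 < 16 / lam := by positivity
      linarith
    · rw [h, one_div_div]
      have : 0 ≤ √(d : ℝ) * √(t : ℝ) / (K : ℝ) ^ (1 / 4 : ℝ) := by positivity
      linarith

lemma IsRun.regretAgainst_le_rate (h : IsRun (1 / 2) P G φ Θ lam e T X A θ ε)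
    (he : IsExploration G φ 𝒵 lam e) (hd : 1 ≤ d) (hφ : ∀ a, Measurable (φ a))
    (hmem : ∀ a x, φ a x ∈ 𝒵) (hle : ∀ z ∈ 𝒵, ∀ ϑ ∈ Θ, |z ⬝ᵥ ϑ| ≤ 1) (hρ : Measurable ρ) :
    regretAgainst P φ T X A θ ε ρ ≤ 32 * (√((d : ℝ) * √(K : ℝ) * T) +
      1 / lam * (√(K : ℝ) + √(√(K : ℝ) * T) / √(d : ℝ))) := by
  have hK := he.pos_arms
  have hl := he.lam_pos
  have hK' : (0 : ℝ) < K := by exact_mod_cast hK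
  have hd' : (0 : ℝ) < d := by exact_mod_cast hd
  have h1 := h.regretAgainst_le he hd hφ hmem hle hρ
  have h2 := sum_learningRate_le (K := K) (T := T) (lam := lam) hd
  have h3 := one_div_learningRate_le hK hd hl T
  -- Both the variance and the exploration are expressed through `η_{t+1}`, for which `√(t + 1)`
  -- never vanishes.
  have h4 : ∑ t ∈ Finset.range T, (4 * d * learningRate K d lam t +
      2 * explorationRate K d lam (t + 1)) ≤
      (8 * d + 16 / lam) * ∑ t ∈ Finset.range T, learningRate K d lam (t + 1) := by
    rw [Finset.mul_sum]
    refine Finset.sum_le_sum fun t _ => ?_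
    have h5 := mul_le_mul_of_nonneg_left
      (learningRate_pred_le hK hd hl (he.lam_mul_dim_le hφ hmem) t) hd'.le
    have h6 : 2 * explorationRate K d lam (t + 1) =
        16 / lam * learningRate K d lam (t + 1) := by
      rw [explorationRate]
      ring
    rw [h6]
    linarith
  have hk2 : √(K : ℝ) = ((K : ℝ) ^ (1 / 4 : ℝ)) ^ 2 := by
    rw [Real.sqrt_eq_rpow, ← Real.rpow_natCast, ← Real.rpow_mul hK'.le]
    norm_num
  have hk : 0 < (K : ℝ) ^ (1 / 4 : ℝ) := by positivity
  have hs1 : √((d : ℝ) * √(K : ℝ) * T) = √(d : ℝ) * (K : ℝ) ^ (1 / 4 : ℝ) * √(T : ℝ) := by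
    rw [Real.sqrt_mul (by positivity), Real.sqrt_mul hd'.le, hk2, Real.sqrt_sq hk.le]
  have hs2 : √(√(K : ℝ) * T) = (K : ℝ) ^ (1 / 4 : ℝ) * √(T : ℝ) := by
    rw [Real.sqrt_mul (by positivity), hk2, Real.sqrt_sq hk.le]
  have hsd : 0 < √(d : ℝ) := Real.sqrt_pos.mpr hd'
  have hdd : √(d : ℝ) ^ 2 = d := Real.sq_sqrt hd'.le
  have hsT : 0 ≤ √(T : ℝ) := Real.sqrt_nonneg _
  rw [hs1, hs2, hk2]
  rw [hk2] at h1
  set k := (K : ℝ) ^ (1 / 4 : ℝ)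
  have h5 : 2 * k ^ 2 / learningRate K d lam T ≤
      2 * (√(d : ℝ) * k * √(T : ℝ)) + 32 * (1 / lam * k ^ 2) := by
    calc 2 * k ^ 2 / learningRate K d lam T = 2 * k ^ 2 * (1 / learningRate K d lam T) := by ring
      _ ≤ 2 * k ^ 2 * (√(d : ℝ) * √(T : ℝ) / k + 16 / lam) :=
          mul_le_mul_of_nonneg_left h3 (by positivity)
      _ = _ := by
          field_simp
          ring
  have h6 : (8 * (d : ℝ) + 16 / lam) * ∑ t ∈ Finset.range T, learningRate K d lam (t + 1) ≤
      16 * (√(d : ℝ) * k * √(T : ℝ)) + 32 * (1 / lam * (k * √(T : ℝ) / √(d : ℝ))) := by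
    refine (mul_le_mul_of_nonneg_left h2 (by positivity)).trans_eq ?_
    nth_rewrite 1 [← hdd]
    field_simp
    ring
  have h7 : 0 ≤ √(d : ℝ) * k * √(T : ℝ) := by positivity
  -- The main term collects `2 + 16`, and each of the two `1 / lam` terms has factor 32, whence the
  -- constant.
  rw [mul_add (1 / lam)]
  linarith

end Regret

end LCTsallisINF

end

theorem theorem4p2 :
    ∃ C : ℝ, 0 < C ∧
      ∀ (Ω : Type*) [MeasurableSpace Ω] (P : Measure Ω) [IsProbabilityMeasure P]
        (𝒳 : Type*) [MeasurableSpace 𝒳] (G : Measure 𝒳) [IsProbabilityMeasure G]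
        (K d T : ℕ) (φ : Fin K → 𝒳 → Fin d → ℝ) (𝒵 Θ : Set (Fin d → ℝ))
        (lam : ℝ) (e : 𝒳 → Fin K → ℝ)
        (X : ℕ → Ω → 𝒳) (A : ℕ → Ω → Fin K)
        (θ : ℕ → Ω → Fin d → ℝ) (ε : ℕ → Ω → Fin K → ℝ),
        1 ≤ d →
        (∀ a, Measurable (φ a)) →
        (∀ a x, φ a x ∈ 𝒵) →
        (∀ z ∈ 𝒵, ∀ ϑ ∈ Θ, |z ⬝ᵥ ϑ| ≤ 1) →
        LCTsallisINF.IsExploration G φ 𝒵 lam e →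
        LCTsallisINF.IsRun (1 / 2) P G φ Θ lam e T X A θ ε →
        BddAbove (Set.range fun ρ : {ρ : 𝒳 → Fin K // Measurable ρ} =>
          LCTsallisINF.regretAgainst P φ T X A θ ε ρ.1) ∧
        LCTsallisINF.regret P φ T X A θ ε ≤
          C * (√((d : ℝ) * √(K : ℝ) * T) +
            1 / lam * (√(K : ℝ) + √(√(K : ℝ) * T) / √(d : ℝ))) := by
  refine ⟨32, by norm_num, ?_⟩
  intro Ω _ P _ 𝒳 _ G _ K d T φ 𝒵 Θ lam e X A θ ε hd hφ hmem hle he hrun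
  have hbound := fun ρ : {ρ : 𝒳 → Fin K // Measurable ρ} =>
    hrun.regretAgainst_le_rate he hd hφ hmem hle ρ.2
  -- `ciSup_le` needs a comparator to exist; a constant one will do. The bound is uniform in `ρ`,
  -- which gives finiteness of the supremum as well.
  have : Nonempty {ρ : 𝒳 → Fin K // Measurable ρ} :=
    ⟨fun _ => ⟨0, he.pos_arms⟩, measurable_const⟩
  exact ⟨⟨_, Set.forall_mem_range.mpr hbound⟩, ciSup_le hbound⟩
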